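/- Let $(X,d)$ be a separable complete metric space, $p\in[1,\infty)$, and let $\Omega\subset\mathbb{R}^n$ ($n\ge 1$) be open and bounded. Let $L^p(\Omega;X)$ be the set of measurable $u:\Omega\to X$ such that $d(u,\xi)\in L^p(\Omega)$ for some $\xi\in X$. Put $\Omega_h=\{x\in\Omega: \operatorname{dist}(x,\partial\Omega)>h\}$ and $c_{n,p}=\frac{n+p}{n\,\omega_n}$, where $\omega_n=\mathcal{L}^n(B_1(0))$. For $u\in L^p(\Omega;X)$ and $h>0$ let $$e^u_{h,p}(x)=c_{n,p}\int_{B_1(0)}\frac{d(u(x),u(x+hv))^p}{h^p}\,dv\ \text{ if } x\in\Omega_h,\qquad e^u_{h,p}(x)=0\ \text{ otherwise},$$ $$E^p(u)=E^p(u,\Omega)=\sup_{f\in C_c(\Omega),\,0\le f\le1}\ \limsup_{h\downarrow0}\int_\Omega e^u_{h,p}(x)f(x)\,dx .$$ An energy measure of $u$ is a finite Borel measure $\mu$ on $\Omega$ with $\lim_{h\downarrow 0}\int_\Omega e^u_{h,p}f\,dx=\int_\Omega f\,d\mu$ for all $f\in C_c(\Omega)$. For $p>1$, $u\in W^{1,p}(\Omega;X)$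 means that $u\in L^p(\Omega;X)$ and $E^p(u)<\infty$; for $p=1$ one requires in addition that $u$ has an energy measure which is absolutely continuous with respect to $\mathcal{L}^n$. Theorem 1. Let $u\in W^{1,p}(\Omega;X)$. Then for every $\xi\in X$ the function $d(u,\xi)$ belongs to $W^{1,p}(\Omega)$. Let $\mathscr{D}\subset X$ be any countable dense subset, let $\nabla (d(u,\xi))$, $\xi\in\mathscr{D}$, be (any representatives of) the weak gradients, and set $$|\partial_\nu u|(x)=\sup_{\xi\in\mathscr{D}}|\nu\cdot\nabla(d(u,\xi))(x)|,\qquad \rho(x)=\frac1{\mathcal{H}^{n-1}(S^{n-1})}\int_{S^{n-1}}|\partial_\nu u|^p(x)\,d\mathcal{H}^{n-1}(\nu),$$ where $\mathcal{H}^{n-1}$ is the Hausdorff measure. Then $\rho$ is measurable on $\Omega$ and $$E^p(u)=\int_\Omega \rho(x)\,dx .$$ The identity localizes: $E^p(u|_{\Omega'},\Omega')=\int_{\Omega'}\rho(x)\,dx$ for every open $\Omega'\subset\Omega$. Moreover $\rho$ is the Korevaar–Schoen energy density of $u$: $\rho\,\mathcal{L}^n$ is an energy measure of $u$, and whenever $h\,\mathcal{L}^n$,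 with $h\ge0$ measurable, is an energy measure of $u$, then $h=\rho$ almost everywhere in $\Omega$. -/

import Mathlib

open MeasureTheory Metric Filter Topology
open scoped ENNReal

/-- The Euclidean space `ℝⁿ`. -/
abbrev Euc (n : ℕ) : Type := EuclideanSpace ℝ (Fin n)

/-- `f` is a nonnegative function in `C_c(Ω)` (extended by zero to `ℝⁿ`). -/
structure IsNonnegCc {n : ℕ} (Ω : Set (Euc n)) (f : Euc n → ℝ) : Prop where
  continuous : Continuous f
  compact : HasCompactSupport f
  support : tsupport f ⊆ Ω
  nonneg : ∀ x, 0 ≤ f x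

/-- `u ∈ L^p(Ω; X)`: `u` is (a.e.) measurable on `Ω` and `x ↦ d(u(x), ξ)` is in `L^p(Ω)`
for some `ξ`. Only the values of `u` on `Ω` matter. -/
def MemLpMap {n : ℕ} {X : Type*} [MetricSpace X] (Ω : Set (Euc n)) (p : ℝ)
    (u : Euc n → X) : Prop :=
  AEStronglyMeasurable u (volume.restrict Ω) ∧
    ∃ ξ : X, MemLp (fun x => dist (u x) ξ) (ENNReal.ofReal p) (volume.restrict Ω)

/-- The set `Ω_h` of points of `Ω` at distance more than `h` from the boundary. -/
def innerSet {n : ℕ} (Ω : Set (Euc n)) (h : ℝ) : Set (Euc n) :=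
  {x | x ∈ Ω ∧ h < infDist x (frontier Ω)}

/-- The constant `c_{n,p} = (n + p) / (n ω_n)`, with `ω_n` the volume of the unit ball. -/
noncomputable def ksConst (n : ℕ) (p : ℝ) : ℝ≥0∞ :=
  ENNReal.ofReal ((n + p) / (n * volume.real (ball (0 : Euc n) 1)))

open Classical in
/-- The approximate energy `e_{h,p}^u(x)` on `Ω`, given by ball averages. -/
noncomputable def approxEnergy {n : ℕ} {X : Type*} [MetricSpace X] (Ω : Set (Euc n)) (p : ℝ)
    (u : Euc n → X) (h : ℝ) (x : Euc n) : ℝ≥0∞ :=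
  if x ∈ innerSet Ω h then
    ksConst n p *
      ∫⁻ v in ball (0 : Euc n) 1, edist (u x) (u (x + h • v)) ^ p / ENNReal.ofReal h ^ p
  else 0

/-- The Korevaar–Schoen `p`-energy `E^p(u)` of `u` on `Ω`. -/
noncomputable def ksEnergy {n : ℕ} {X : Type*} [MetricSpace X] (Ω : Set (Euc n)) (p : ℝ)
    (u : Euc n → X) : ℝ≥0∞ :=
  ⨆ (f : Euc n → ℝ) (_ : IsNonnegCc Ω f ∧ ∀ x, f x ≤ 1),
    limsup (fun h : ℝ => ∫⁻ x in Ω, approxEnergy Ω p u h x * ENNReal.ofReal (f x)) (𝓝[>] 0)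

/-- The finite measure `μ` on `Ω` is the weak limit, as `h → 0`, of the measures
`e_{h,p}^u dx` (tested against `C_c(Ω)`; by linearity nonnegative functions suffice). -/
structure IsEnergyMeasure {n : ℕ} {X : Type*} [MetricSpace X] (Ω : Set (Euc n)) (p : ℝ)
    (u : Euc n → X) (μ : Measure (Euc n)) : Prop where
  finite : IsFiniteMeasure μ
  compl : μ Ωᶜ = 0
  tendsto : ∀ f : Euc n → ℝ, IsNonnegCc Ω f →
    Tendsto (fun h : ℝ => ∫⁻ x in Ω, approxEnergy Ω p u h x * ENNReal.ofReal (f x))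
      (𝓝[>] 0) (𝓝 (∫⁻ x, ENNReal.ofReal (f x) ∂μ))

/-- The Korevaar–Schoen space `W^{1,p}(Ω; X)`: maps in `L^p(Ω; X)` with finite `p`-energy and,
for `p = 1`, with absolutely continuous limit measure. -/
structure MemKSSobolev {n : ℕ} {X : Type*} [MetricSpace X] (Ω : Set (Euc n)) (p : ℝ)
    (u : Euc n → X) : Prop where
  memLp : MemLpMap Ω p u
  energy_lt_top : ksEnergy Ω p u < ⊤
  absCont : p = 1 → ∃ μ : Measure (Euc n), IsEnergyMeasure Ω p u μ ∧ μ ≪ volume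

/-- `G` is a weak (distributional) gradient of `f : Ω → ℝ`. -/
structure IsWeakGradient {n : ℕ} (Ω : Set (Euc n)) (f : Euc n → ℝ) (G : Euc n → Euc n) :
    Prop where
  locInt : LocallyIntegrableOn f Ω
  locInt_grad : LocallyIntegrableOn G Ω
  integral_eq : ∀ ψ : Euc n → ℝ, ContDiff ℝ (⊤ : ℕ∞) ψ → HasCompactSupport ψ → tsupport ψ ⊆ Ω →
    ∀ w : Euc n, ∫ x in Ω, f x * fderiv ℝ ψ x w = -∫ x in Ω, inner ℝ w (G x) * ψ x

/-- The directional derivative modulus `|∂_ν u|(x) = sup_{ξ ∈ D} |ν · ∇ d(u, ξ)(x)|`, where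
`G ξ` is (a representative of) the weak gradient of `d(u, ξ)`. -/
noncomputable def absPartial {n : ℕ} {X : Type*} (D : Set X) (G : X → Euc n → Euc n)
    (ν x : Euc n) : ℝ≥0∞ :=
  ⨆ ξ ∈ D, ‖(inner ℝ ν (G ξ x) : ℝ)‖ₑ

/-- The average over the unit sphere `S^{n-1}`, with respect to the Hausdorff measure
`H^{n-1}` (whose normalization cancels in an average), of `ν ↦ |∂_ν u|^p(x)`. -/
noncomputable def sphereDensity {n : ℕ} {X : Type*} (p : ℝ) (D : Set X)
    (G : X → Euc n → Euc n) (x : Euc n) : ℝ≥0∞ :=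
  ⨍⁻ ν in sphere (0 : Euc n) 1, absPartial D G ν x ^ p ∂(Measure.hausdorffMeasure ((n : ℝ) - 1))

/-! Fix an enumeration `ξ j` of the dense set, weak gradients `g j` of `d(u, ξ j)`, and put Γ(x) = c
∫_B sup_j |v · g_j(x)|^p dv, with B the unit ball. The heart of the proof is that ∫ e_h η → ∫ η Γ
for every nonnegative η ∈ C_c(Ω). The energy, its localization and the energy measure then follow by
taking suprema over cutoffs, and uniqueness holds because C_c(Ω) determines finite measures on Ω.

Lower bound (`lintegral_gradSup_le_liminf`): d(u(x), u(x+hv))/h dominates every difference quotient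
of d(u, ξ_j), and these converge to v · g_j in L¹ on compact sets. Fatou in x along a diagonal
subsequence, then Fatou in v, give the inequality.

Upper bound (`limsup_quotEnergy_le`): by density d(a, b) = sup_j |d(a, ξ_j) - d(b, ξ_j)|.
Integrating the weak gradients along segments bounds d(u(x), u(x+hv)) by a line integral of sup_j |v
· g_j|. Jensen and a translation move the segment onto η, whose uniform continuity costs an error ε
∫_Ω Γ. This error vanishes because the lower bound and E^p(u) < ∞ make Γ integrable.

Weak gradients exist by duality (`exists_integrable_isWeakGradient`). Averaging difference quotients
over v with weight w · v recovers, up to a positive constant, the distributional derivative in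
direction w, and bounds its pairing with ψ by averages of |ψ(x)| d(u(x), u(x+hv))/h. For p > 1,
Hölder turns this into a bound by an L^q norm of ψ with q < ∞; for p = 1 the energy measure μ gives
a bound by ‖ψ‖ in L¹(μ), and μ ≪ volume. Hahn–Banach and Radon–Nikodym then produce an integrable
density. Its p-integrability is the lower bound again, applied to a single ξ.

Finally Γ = ρ almost everywhere: the integrand is p-homogeneous in v, so polar coordinates turn the
ball integral into an integral against the cone measure, which is proportional to the Hausdorff
measure because both are rotation invariant. -/

/-! ### The Hausdorff measure of the unit sphere -/

lemma norm_inv_norm_smul_sub_le {E : Type*} [NormedAddCommGroup E] [NormedSpace ℝ E] {x y : E}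
    (hx : 1 ≤ ‖x‖) (hy : 1 ≤ ‖y‖) : ‖‖x‖⁻¹ • x - ‖y‖⁻¹ • y‖ ≤ 2 * ‖x - y‖ := by
  have hx0 : 0 < ‖x‖ := by linarith
  have hy0 : 0 < ‖y‖ := by linarith
  have e : ‖x‖⁻¹ • x - ‖y‖⁻¹ • y = ‖x‖⁻¹ • (x - y) + (‖x‖⁻¹ - ‖y‖⁻¹) • y := by
    rw [smul_sub, sub_smul]; abel
  have h1 : ‖‖x‖⁻¹ • (x - y)‖ ≤ ‖x - y‖ := by
    rw [norm_smul, norm_inv, norm_norm]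
    exact mul_le_of_le_one_left (norm_nonneg _) (inv_le_one_of_one_le₀ hx)
  have h2 : ‖(‖x‖⁻¹ - ‖y‖⁻¹) • y‖ ≤ ‖x - y‖ := by
    have : (‖x‖⁻¹ - ‖y‖⁻¹) * ‖y‖ = ‖x‖⁻¹ * (‖y‖ - ‖x‖) := by field_simp
    rw [norm_smul, ← abs_norm y, Real.norm_eq_abs, abs_norm, ← abs_of_pos hy0, ← abs_mul,
      abs_of_pos hy0, this, abs_mul, abs_of_pos (inv_pos.2 hx0)]
    refine (mul_le_of_le_one_left (abs_nonneg _) (inv_le_one_of_one_le₀ hx)).trans ?_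
    rw [abs_sub_comm]; exact abs_norm_sub_norm_le _ _
  rw [e]
  linarith [norm_add_le (‖x‖⁻¹ • (x - y)) ((‖x‖⁻¹ - ‖y‖⁻¹) • y)]

lemma finrank_orthogonal_span_of_unit {n : ℕ} {v : Euc n} (hv : ‖v‖ = 1) (hn : 0 < n) :
    ((Module.finrank ℝ (ℝ ∙ v)ᗮ : ℕ) : ℝ) = (n : ℝ) - 1 := by
  obtain ⟨m, rfl⟩ : ∃ m, n = m + 1 := ⟨n - 1, by omega⟩
  have : Fact (Module.finrank ℝ (Euc (m + 1)) = m + 1) := ⟨by simp⟩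
  rw [Submodule.finrank_orthogonal_span_singleton (n := m) (by rintro rfl; simp at hv)]
  push_cast; ring

/-- By compactness a local bound suffices. Near v the sphere is the radial projection of a bounded
piece of the tangent hyperplane v + v^⊥; the hyperplane lies outside the open unit ball, so this
projection is 2-Lipschitz. -/
lemma hausdorffMeasure_sphere_lt_top {n : ℕ} (hn : 0 < n) :
    Measure.hausdorffMeasure ((n : ℝ) - 1) (sphere (0 : Euc n) 1) < ⊤ := by
  have hd : (0 : ℝ) ≤ (n : ℝ) - 1 := by
    have : (1 : ℝ) ≤ n := by exact_mod_cast hn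
    linarith
  refine (isCompact_sphere _ _).measure_lt_top_of_nhdsWithin fun v hv => ?_
  have hv1 : ‖v‖ = 1 := by simpa using hv
  let K := (ℝ ∙ v)ᗮ
  let φ : K → Euc n := fun w => ‖v + (w : Euc n)‖⁻¹ • (v + (w : Euc n))
  have orth (w : K) : inner ℝ v (w : Euc n) = 0 :=
    (Submodule.mem_orthogonal_singleton_iff_inner_right.1 w.2)
  have hge (w : K) : 1 ≤ ‖v + (w : Euc n)‖ := by
    have := norm_add_sq_eq_norm_sq_add_norm_sq_of_inner_eq_zero v (w : Euc n) (orth w)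
    nlinarith [norm_nonneg (v + (w : Euc n)), norm_nonneg (w : Euc n)]
  have hφ : LipschitzWith 2 φ := LipschitzWith.of_dist_le_mul fun w w' => by
    rw [dist_eq_norm]
    refine (norm_inv_norm_smul_sub_le (hge w) (hge w')).trans (le_of_eq ?_)
    rw [dist_eq_norm, add_sub_add_left_eq_sub]; rfl
  have hK := finrank_orthogonal_span_of_unit hv1 hn
  have hfin : Measure.hausdorffMeasure ((n : ℝ) - 1) (φ '' closedBall 0 3) < ⊤ := by
    refine (hφ.hausdorffMeasure_image_le hd _).trans_lt (ENNReal.mul_lt_top ?_ ?_)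
    · exact ENNReal.rpow_lt_top_of_nonneg hd (by simp)
    · rw [← hK]
      exact (isCompact_closedBall (0 : K) 3).measure_lt_top
  -- A point x of the sphere with t = ⟨v, x⟩ > 1/2 is the projection of t⁻¹x, whose offset from v
  -- has norm at most 2 + 1 = 3.
  refine ⟨φ '' closedBall 0 3, ?_, hfin⟩
  have ho : {x : Euc n | (1 / 2 : ℝ) < inner ℝ v x} ∈ 𝓝 v :=
    (isOpen_lt (by fun_prop) (by fun_prop)).mem_nhds (by simp [hv1]; norm_num)
  filter_upwards [mem_nhdsWithin_of_mem_nhds ho, self_mem_nhdsWithin] with x hx hxS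
  have hx1 : ‖x‖ = 1 := by simpa using hxS
  set t : ℝ := inner ℝ v x with ht
  have ht2 : (1 / 2 : ℝ) < t := hx
  have ht0 : 0 < t := by linarith
  have hmem : t⁻¹ • x - v ∈ K := by
    rw [Submodule.mem_orthogonal_singleton_iff_inner_right, inner_sub_right, inner_smul_right,
      ← ht, real_inner_self_eq_norm_sq, hv1]
    field_simp; simp
  have hti : t⁻¹ ≤ 2 := by
    rw [inv_le_comm₀ ht0 (by norm_num)]; linarith
  refine ⟨⟨t⁻¹ • x - v, hmem⟩, ?_, ?_⟩
  · rw [mem_closedBall_zero_iff]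
    change ‖t⁻¹ • x - v‖ ≤ 3
    refine (norm_sub_le _ _).trans ?_
    rw [norm_smul, hx1, hv1, norm_inv, Real.norm_of_nonneg ht0.le]
    linarith
  · change ‖v + (t⁻¹ • x - v)‖⁻¹ • (v + (t⁻¹ • x - v)) = x
    rw [add_sub_cancel, norm_smul, hx1, norm_inv, Real.norm_of_nonneg ht0.le, smul_smul]
    field_simp; simp

/-- Orthogonal projection onto v^⊥ does not increase Hausdorff measure, and the image of the sphere
contains the open unit ball of v^⊥. -/
lemma hausdorffMeasure_sphere_ne_zero {n : ℕ} (hn : 0 < n) :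
    Measure.hausdorffMeasure ((n : ℝ) - 1) (sphere (0 : Euc n) 1) ≠ 0 := by
  have hd : (0 : ℝ) ≤ (n : ℝ) - 1 := by
    have : (1 : ℝ) ≤ n := by exact_mod_cast hn
    linarith
  have : Nonempty (Fin n) := ⟨⟨0, hn⟩⟩
  obtain ⟨v, hv1⟩ := exists_norm_eq (Euc n) (zero_le_one)
  let K := (ℝ ∙ v)ᗮ
  have hK := finrank_orthogonal_span_of_unit hv1 hn
  have orth (w : K) : inner ℝ v (w : Euc n) = 0 :=
    (Submodule.mem_orthogonal_singleton_iff_inner_right.1 w.2)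
  have hpos : Measure.hausdorffMeasure ((n : ℝ) - 1) (ball (0 : K) 1) ≠ 0 := by
    rw [← hK]
    exact isOpen_ball.measure_ne_zero _ ⟨0, by simp⟩
  have hle := hausdorffMeasure_orthogonalProjectionOnto_le K ((n : ℝ) - 1)
    (sphere (0 : Euc n) 1) hd
  intro h0
  rw [h0, nonpos_iff_eq_zero] at hle
  refine hpos (measure_mono_null ?_ hle)
  intro w hw
  have hw1 : ‖(w : Euc n)‖ < 1 := by simpa using hw
  set s : ℝ := Real.sqrt (1 - ‖(w : Euc n)‖ ^ 2)
  have hs : s ^ 2 = 1 - ‖(w : Euc n)‖ ^ 2 := Real.sq_sqrt (by nlinarith [norm_nonneg (w : Euc n)])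
  refine ⟨s • v + w, ?_, ?_⟩
  · have := norm_add_sq_eq_norm_sq_add_norm_sq_of_inner_eq_zero (s • v) (w : Euc n)
      (by rw [inner_smul_left, orth w]; simp)
    rw [norm_smul, hv1, mul_one, Real.norm_eq_abs] at this
    have h2 : ‖s • v + (w : Euc n)‖ ^ 2 = 1 := by
      rw [sq, this, ← sq, sq_abs, hs]; ring
    rw [mem_sphere_zero_iff_norm]
    nlinarith [norm_nonneg (s • v + (w : Euc n))]
  · rw [map_add, Submodule.orthogonalProjectionOnto_mem_subspace_eq_self]
    have : K.orthogonalProjectionOnto (s • v) = 0 := by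
      rw [Submodule.orthogonalProjectionOnto_eq_zero_iff, Submodule.orthogonal_orthogonal]
      exact Submodule.smul_mem _ _ (Submodule.mem_span_singleton_self v)
    rw [this, zero_add]

/-! ### Spherical averages as ball integrals -/

/-- Two finite measures on a compact metric space for which balls of equal radii have equal
masses are proportional. -/
lemma measure_proportional_of_uniform {S : Type*} [MetricSpace S] [CompactSpace S]
    [MeasurableSpace S] [BorelSpace S] (μ ν : Measure S) [IsFiniteMeasure μ] [IsFiniteMeasure ν]
    (hμ : ∀ x y r, μ (ball x r) = μ (ball y r)) (hν : ∀ x y r, ν (ball x r) = ν (ball y r)) :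
    ν Set.univ • μ = μ Set.univ • ν := by
  rcases eq_or_ne ν 0 with rfl | hν0
  · simp
  have : NeZero ν := ⟨hν0⟩
  have : Nonempty S := by
    by_contra h
    rw [not_nonempty_iff] at h
    exact hν0 (Measure.eq_zero_of_isEmpty ν)
  obtain ⟨o⟩ := this
  have : IsFiniteMeasure (ν Set.univ • μ) := μ.smul_finite (measure_ne_top ν _)
  have : IsFiniteMeasure (μ Set.univ • ν) := ν.smul_finite (measure_ne_top μ _)
  have hpos : ∀ r : ℝ, 0 < r → 0 < ν.real (ball o r) := by
    intro r hr
    refine ENNReal.toReal_pos (fun h0 => hν0 ?_) (measure_ne_top _ _)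
    rw [← Measure.measure_univ_eq_zero]
    exact isCompact_univ.measure_zero_of_nhdsWithin fun x _ =>
      ⟨ball x r, mem_nhdsWithin_of_mem_nhds (ball_mem_nhds x hr), by rw [hν x o r, h0]⟩
  refine ext_of_forall_integral_eq_of_IsFiniteMeasure fun F => ?_
  rw [integral_smul_measure, integral_smul_measure]
  change ν.real Set.univ * _ = μ.real Set.univ * _
  have huc : UniformContinuous F := CompactSpace.uniformContinuous_of_continuous F.continuous
  rw [Metric.uniformContinuous_iff] at huc
  -- Christensen's argument: integrate F(x) and F(y) against the indicator k of {dist x y < r} for μ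
  -- × ν. The two integrals are ν(B_r) ∫ F dμ and μ(B_r) ∫ F dν, and they differ by at most ε times
  -- the mass of k. Computing that mass in both orders relates μ(B_r) to ν(B_r).
  have key : ∀ ε > 0, |ν.real Set.univ * ∫ x, F x ∂μ - μ.real Set.univ * ∫ x, F x ∂ν|
      ≤ ε * μ.real Set.univ * ν.real Set.univ := by
    intro ε hε
    obtain ⟨r, hr, hF⟩ := huc ε hε
    set k : S × S → ℝ := fun z => Set.indicator {z : S × S | dist z.1 z.2 < r} 1 z with hk
    have hkm : MeasurableSet {z : S × S | dist z.1 z.2 < r} :=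
      (isOpen_lt (by fun_prop) (by fun_prop)).measurableSet
    have hk0 : ∀ z, 0 ≤ k z := fun z => Set.indicator_nonneg (fun _ _ => zero_le_one) _
    have hk1 : ∀ z, k z ≤ 1 := fun z => Set.indicator_le_self' (fun _ _ => zero_le_one) _
    have hki : Integrable k (μ.prod ν) := (integrable_const (1 : ℝ)).indicator hkm
    have hFi : ∀ G : S × S → ℝ, Continuous G → Integrable (fun z => G z * k z) (μ.prod ν) := by
      intro G hG
      obtain ⟨C, hC⟩ := isCompact_univ.exists_bound_of_continuousOn hG.continuousOn
      exact hki.bdd_mul hG.aestronglyMeasurable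
        (ae_of_all _ fun z => hC z (Set.mem_univ z))
    have hkx : ∀ x, ∫ y, k (x, y) ∂ν = ν.real (ball o r) := by
      intro x
      have : (fun y => k (x, y)) = (ball x r).indicator 1 := by
        ext y; simp [hk, Set.indicator, mem_ball, dist_comm]
      rw [this, integral_indicator_one measurableSet_ball, measureReal_def, hν x o, measureReal_def]
    have hky : ∀ y, ∫ x, k (x, y) ∂μ = μ.real (ball o r) := by
      intro y
      have : (fun x => k (x, y)) = (ball y r).indicator 1 := by
        ext y; simp [hk, Set.indicator, mem_ball]
      rw [this, integral_indicator_one measurableSet_ball, measureReal_def, hμ y o, measureReal_def]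
    have e1 : ∫ z, F z.1 * k z ∂(μ.prod ν) = (∫ x, F x ∂μ) * ν.real (ball o r) := by
      rw [integral_prod _ (hFi (fun z => F z.1) (by fun_prop)), ← integral_mul_const]
      refine integral_congr_ae (ae_of_all _ fun x => ?_)
      simp only [integral_const_mul, hkx]
    have e2 : ∫ z, F z.2 * k z ∂(μ.prod ν) = (∫ x, F x ∂ν) * μ.real (ball o r) := by
      rw [integral_prod_symm _ (hFi (fun z => F z.2) (by fun_prop)), ← integral_mul_const]
      refine integral_congr_ae (ae_of_all _ fun x => ?_)
      simp only [integral_const_mul, hky]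
    have e3 : ∫ z, k z ∂(μ.prod ν) = μ.real Set.univ * ν.real (ball o r) := by
      rw [integral_prod _ hki]; simp [hkx]
    have e4 : ∫ z, k z ∂(μ.prod ν) = ν.real Set.univ * μ.real (ball o r) := by
      rw [integral_prod_symm _ hki]; simp [hky]
    have hb : |∫ z, F z.1 * k z ∂(μ.prod ν) - ∫ z, F z.2 * k z ∂(μ.prod ν)|
        ≤ ε * (μ.real Set.univ * ν.real (ball o r)) := by
      rw [← integral_sub (hFi (fun z => F z.1) (by fun_prop)) (hFi (fun z => F z.2) (by fun_prop)),
        ← e3, ← integral_const_mul, ← Real.norm_eq_abs]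
      refine norm_integral_le_of_norm_le (hki.const_mul ε) (ae_of_all _ fun z => ?_)
      rw [← sub_mul, norm_mul, Real.norm_of_nonneg (hk0 z)]
      by_cases hz : dist z.1 z.2 < r
      · exact mul_le_mul_of_nonneg_right (by rw [← dist_eq_norm]; exact (hF hz).le) (hk0 z)
      · simp [hk, hz]
    have h34 : μ.real Set.univ * ν.real (ball o r) = ν.real Set.univ * μ.real (ball o r) :=
      e3.symm.trans e4
    rw [e1, e2] at hb
    have hn0 : 0 ≤ ν.real Set.univ := measureReal_nonneg
    have := mul_le_mul_of_nonneg_left hb hn0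
    rw [← abs_of_nonneg hn0, ← abs_mul, abs_of_nonneg hn0] at this
    have hs := hpos r hr
    refine le_of_mul_le_mul_right ?_ hs
    rw [← abs_of_pos hs, ← abs_mul, abs_of_pos hs]
    calc _ = |ν.real Set.univ * ((∫ x, F x ∂μ) * ν.real (ball o r)
            - (∫ x, F x ∂ν) * μ.real (ball o r))| := by
          congr 1
          linear_combination (-(∫ x, F x ∂ν)) * h34
      _ ≤ _ := this
      _ = _ := by ring
  by_contra hne
  have hd := abs_pos.2 (sub_ne_zero.2 hne)
  set M := μ.real Set.univ * ν.real Set.univ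
  have hM : 0 ≤ M := by positivity
  have := key (|ν.real Set.univ * ∫ x, F x ∂μ - μ.real Set.univ * ∫ x, F x ∂ν| / (2 * (M + 1)))
    (by positivity)
  rw [mul_assoc, div_mul_eq_mul_div, le_div_iff₀ (by positivity)] at this
  change _ ≤ _ * M at this
  nlinarith

lemma exists_linearIsometryEquiv_map_eq {E : Type*} [NormedAddCommGroup E] [InnerProductSpace ℝ E]
    {x y : E} (h : ‖x‖ = ‖y‖) : ∃ e : E ≃ₗᵢ[ℝ] E, e x = y :=
  ⟨(ℝ ∙ (x - y))ᗮ.reflection, Submodule.reflection_sub h⟩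

/-- The action of a linear isometry on the unit sphere. -/
noncomputable def sphereIsometryEquiv {n : ℕ} (e : Euc n ≃ₗᵢ[ℝ] Euc n) :
    sphere (0 : Euc n) 1 ≃ᵢ sphere (0 : Euc n) 1 where
  toFun x := ⟨e x, by simp⟩
  invFun x := ⟨e.symm x, by simp⟩
  left_inv x := by simp
  right_inv x := by simp
  isometry_toFun x y := by
    simp only [Subtype.edist_eq]
    exact e.isometry.edist_eq _ _

lemma sphereIsometryEquiv_coe {n : ℕ} (e : Euc n ≃ₗᵢ[ℝ] Euc n) (x : sphere (0 : Euc n) 1) :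
    (sphereIsometryEquiv e x : Euc n) = e x := rfl

lemma exists_sphereIsometryEquiv_image_ball {n : ℕ} (x y : sphere (0 : Euc n) 1) :
    ∃ e : Euc n ≃ₗᵢ[ℝ] Euc n, ∀ r, sphereIsometryEquiv e '' ball x r = ball y r := by
  obtain ⟨e, he⟩ := exists_linearIsometryEquiv_map_eq
    (x := (x : Euc n)) (y := (y : Euc n)) (by simp)
  refine ⟨e, fun r => ?_⟩
  rw [IsometryEquiv.image_ball]
  congr 1
  exact Subtype.ext he

open scoped Pointwise in
-- `toSphere` measures the cone over a set, and a linear isometry taking x to y carries cones to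
-- cones and preserves volume.
lemma toSphere_ball_eq {n : ℕ} (x y : sphere (0 : Euc n) 1) (r : ℝ) :
    (volume : Measure (Euc n)).toSphere (ball x r) =
      (volume : Measure (Euc n)).toSphere (ball y r) := by
  obtain ⟨e, he⟩ := exists_sphereIsometryEquiv_image_ball x y
  rw [Measure.toSphere_apply' _ measurableSet_ball, Measure.toSphere_apply' _ measurableSet_ball,
    ← he r]
  have : Set.Ioo (0 : ℝ) 1 • ((↑) '' (sphereIsometryEquiv e '' ball x r) : Set (Euc n)) =
      e '' (Set.Ioo (0 : ℝ) 1 • ((↑) '' ball x r : Set (Euc n))) := by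
    ext z
    simp only [Set.mem_smul, Set.mem_image]
    constructor
    · rintro ⟨t, ht, _, ⟨_, ⟨w, hw, rfl⟩, rfl⟩, rfl⟩
      exact ⟨t • (w : Euc n), ⟨t, ht, w, ⟨w, hw, rfl⟩, rfl⟩, by simp [sphereIsometryEquiv_coe]⟩
    · rintro ⟨_, ⟨t, ht, _, ⟨w, hw, rfl⟩, rfl⟩, rfl⟩
      exact ⟨t, ht, _, ⟨_, ⟨w, hw, rfl⟩, rfl⟩, by simp [sphereIsometryEquiv_coe]⟩
  rw [this]
  congr 1
  have hm := (LinearIsometryEquiv.measurePreserving e).measure_preimage_emb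
    (s := e '' (Set.Ioo (0 : ℝ) 1 • ((↑) '' ball x r : Set (Euc n))))
    e.toMeasurableEquiv.measurableEmbedding
  rwa [Set.preimage_image_eq _ e.injective] at hm

lemma hausdorffMeasure_sphere_ball_eq {n : ℕ} (d : ℝ) (x y : sphere (0 : Euc n) 1) (r : ℝ) :
    Measure.hausdorffMeasure d (ball x r) = Measure.hausdorffMeasure d (ball y r) := by
  obtain ⟨e, he⟩ := exists_sphereIsometryEquiv_image_ball x y
  rw [← he r, IsometryEquiv.hausdorffMeasure_image]

/-- Averages over the unit sphere may be computed with the cone measure. -/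
lemma laverage_hausdorffMeasure_sphere {n : ℕ} (hn : 0 < n) {F : Euc n → ℝ≥0∞}
    (hF : Measurable F) :
    ⨍⁻ ν in sphere (0 : Euc n) 1, F ν ∂(Measure.hausdorffMeasure ((n : ℝ) - 1)) =
      (∫⁻ ν, F ν ∂(volume : Measure (Euc n)).toSphere) /
        (volume : Measure (Euc n)).toSphere Set.univ := by
  have hd : (0 : ℝ) ≤ (n : ℝ) - 1 := by
    have : (1 : ℝ) ≤ n := by exact_mod_cast hn
    linarith
  have hn' : Nonempty (Fin n) := ⟨⟨0, hn⟩⟩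
  set σ := (volume : Measure (Euc n)).toSphere
  set H : Measure (sphere (0 : Euc n) 1) := Measure.hausdorffMeasure ((n : ℝ) - 1)
  have hmap : Measure.map Subtype.val H =
      (Measure.hausdorffMeasure ((n : ℝ) - 1)).restrict (sphere (0 : Euc n) 1) := by
    rw [isometry_subtype_coe.map_hausdorffMeasure (Or.inl hd), Subtype.range_coe]
  have hHu : H Set.univ = Measure.hausdorffMeasure ((n : ℝ) - 1) (sphere (0 : Euc n) 1) := by
    have := congrArg (fun m => m Set.univ) hmap
    simpa [Measure.map_apply measurable_subtype_coe .univ] using this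
  have : IsFiniteMeasure H := ⟨by rw [hHu]; exact hausdorffMeasure_sphere_lt_top hn⟩
  have hprop := measure_proportional_of_uniform H σ
    (fun x y r => hausdorffMeasure_sphere_ball_eq _ x y r) toSphere_ball_eq
  have hi := congrArg (fun m : Measure (sphere (0 : Euc n) 1) => ∫⁻ ν, F ν ∂m) hprop
  simp only [lintegral_smul_measure, smul_eq_mul] at hi
  have hσ0 : σ Set.univ ≠ 0 := by
    rw [Measure.measure_univ_ne_zero]; exact Measure.toSphere_ne_zero _
  have hσt : σ Set.univ ≠ ⊤ := measure_ne_top _ _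
  have hH0 : H Set.univ ≠ 0 := by rw [hHu]; exact hausdorffMeasure_sphere_ne_zero hn
  have hHt : H Set.univ ≠ ⊤ := measure_ne_top _ _
  rw [setLAverage_eq, ← hHu, ← hmap, lintegral_map hF measurable_subtype_coe,
    ENNReal.div_eq_div_iff hσ0 hσt hH0 hHt, hi]

/-- The radial factor in polar coordinates, ∫₀¹ r^(m+p) dr; it is used with m = n - 1. -/
lemma lintegral_volumeIoiPow_rpow {m : ℕ} {p : ℝ} (hp : 0 ≤ p) :
    ∫⁻ r : Set.Ioi (0 : ℝ), (Set.Iio (1 : ℝ)).indicator (fun r => ENNReal.ofReal r ^ p) r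
      ∂(Measure.volumeIoiPow m) = ENNReal.ofReal (1 / (m + 1 + p)) := by
  have hk : Measurable ((Set.Iio (1 : ℝ)).indicator (fun r => ENNReal.ofReal r ^ p)) :=
    Measurable.indicator (by fun_prop) measurableSet_Iio
  rw [Measure.volumeIoiPow]
  erw [lintegral_withDensity_eq_lintegral_mul _ (by fun_prop) (hk.comp measurable_subtype_coe)]
  simp only [Pi.mul_apply, Function.comp_apply]
  rw [lintegral_subtype_comap measurableSet_Ioi (fun r : ℝ => ENNReal.ofReal (r ^ m) *
    (Set.Iio (1 : ℝ)).indicator (fun r => ENNReal.ofReal r ^ p) r)]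
  have h1 : ∀ r ∈ Set.Ioi (0 : ℝ), ENNReal.ofReal (r ^ m) *
      (Set.Iio (1 : ℝ)).indicator (fun r => ENNReal.ofReal r ^ p) r =
      (Set.Iio (1 : ℝ)).indicator (fun r => ENNReal.ofReal (r ^ ((m : ℝ) + p))) r := by
    intro r hr
    by_cases h : r ∈ Set.Iio (1 : ℝ)
    · rw [Set.indicator_of_mem h, Set.indicator_of_mem h, ENNReal.ofReal_rpow_of_pos hr,
        ← ENNReal.ofReal_mul (pow_nonneg hr.le _), ← Real.rpow_natCast, ← Real.rpow_add hr]
    · rw [Set.indicator_of_notMem h, Set.indicator_of_notMem h, mul_zero]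
  have hmp : 0 ≤ (m : ℝ) + p := by positivity
  rw [setLIntegral_congr_fun measurableSet_Ioi h1, lintegral_indicator measurableSet_Iio,
    Measure.restrict_restrict measurableSet_Iio, Set.inter_comm, Set.Ioi_inter_Iio,
    Measure.restrict_congr_set Ioo_ae_eq_Ioc, ← ofReal_integral_eq_lintegral_ofReal,
    ← intervalIntegral.integral_of_le zero_le_one, integral_rpow (Or.inl (by linarith))]
  · rw [Real.one_rpow, Real.zero_rpow (by linarith)]
    congr 1; ring
  · exact (intervalIntegrable_iff_integrableOn_Ioc_of_le zero_le_one).1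
      (intervalIntegral.intervalIntegrable_rpow' (by linarith))
  · filter_upwards [ae_restrict_mem measurableSet_Ioc] with y hy
    exact Real.rpow_nonneg hy.1.le _

/-- Homogeneity makes the integrand a product of a spherical and a radial function in polar
coordinates. -/
lemma lintegral_ball_eq_toSphere {n : ℕ} (hn : 0 < n) {p : ℝ} (hp : 0 ≤ p) {F : Euc n → ℝ≥0∞}
    (hF : Measurable F)
    (hom : ∀ r : ℝ, 0 < r → ∀ x, F (r • x) = ENNReal.ofReal r ^ p * F x) :
    ∫⁻ x in ball (0 : Euc n) 1, F x =
      (∫⁻ ν, F ν ∂(volume : Measure (Euc n)).toSphere) * ENNReal.ofReal (1 / (n + p)) := by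
  have hn' : Nonempty (Fin n) := ⟨⟨0, hn⟩⟩
  set k : ℝ → ℝ≥0∞ := (Set.Iio (1 : ℝ)).indicator (fun r => ENNReal.ofReal r ^ p)
  have hk : Measurable k := Measurable.indicator (by fun_prop) measurableSet_Iio
  have hpolar : ∀ x : ({0}ᶜ : Set (Euc n)), (ball (0 : Euc n) 1).indicator F x =
      (fun z : sphere (0 : Euc n) 1 × Set.Ioi (0 : ℝ) => F z.1 * k z.2)
        (homeomorphUnitSphereProd (Euc n) x) := by
    rintro ⟨x, hx⟩
    have hx0 : 0 < ‖x‖ := norm_pos_iff.2 hx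
    have hxe : F x = ENNReal.ofReal ‖x‖ ^ p * F (‖x‖⁻¹ • x) := by
      rw [← hom _ hx0, smul_smul, mul_inv_cancel₀ hx0.ne', one_smul]
    by_cases h : ‖x‖ < 1
    · simp only [Set.indicator, mem_ball_zero_iff, h, if_true, k, homeomorphUnitSphereProd,
        Set.mem_Iio]
      simpa [h, mul_comm] using hxe
    · simp [Set.indicator, h, k]
  have h1 : ∫⁻ x in ball (0 : Euc n) 1, F x =
      ∫⁻ x in ({0}ᶜ : Set (Euc n)), (ball (0 : Euc n) 1).indicator F x := by
    rw [← lintegral_indicator measurableSet_ball, restrict_compl_singleton]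
  rw [h1, ← lintegral_subtype_comap (measurableSet_singleton _).compl]
  rw [lintegral_congr hpolar, (Measure.measurePreserving_homeomorphUnitSphereProd
      (volume : Measure (Euc n))).lintegral_comp (f := fun z => F z.1 * k z.2) (by fun_prop),
    lintegral_prod_mul (f := fun x : sphere (0 : Euc n) 1 => F x)
      (g := fun r : Set.Ioi (0 : ℝ) => k r) (by fun_prop) (by fun_prop), lintegral_volumeIoiPow_rpow hp]
  congr 3
  have : Module.finrank ℝ (Euc n) = n := by simp
  rw [this, Nat.cast_pred hn]; ring

/-- For a `p`-homogeneous function the normalized ball integral is the spherical average. -/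
lemma ksConst_mul_lintegral_ball {n : ℕ} (hn : 0 < n) {p : ℝ} (hp : 0 ≤ p) {F : Euc n → ℝ≥0∞}
    (hF : Measurable F)
    (hom : ∀ r : ℝ, 0 < r → ∀ x, F (r • x) = ENNReal.ofReal r ^ p * F x) :
    ksConst n p * ∫⁻ x in ball (0 : Euc n) 1, F x =
      ⨍⁻ ν in sphere (0 : Euc n) 1, F ν ∂(Measure.hausdorffMeasure ((n : ℝ) - 1)) := by
  have hn' : Nonempty (Fin n) := ⟨⟨0, hn⟩⟩
  have hn0 : (0 : ℝ) < n := by exact_mod_cast hn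
  rw [laverage_hausdorffMeasure_sphere hn hF, lintegral_ball_eq_toSphere hn hp hF hom,
    Measure.toSphere_apply_univ, ENNReal.div_eq_inv_mul, mul_left_comm, mul_comm]
  congr 1
  have hb : 0 < volume.real (ball (0 : Euc n) 1) :=
    ENNReal.toReal_pos (isOpen_ball.measure_ne_zero _ ⟨0, by simp⟩) measure_ball_lt_top.ne
  -- The cone measure has total mass n ω_n, so `ksConst` times the radial factor 1/(n+p) is exactly
  -- its inverse.
  have : (Module.finrank ℝ (Euc n) : ℝ≥0∞) * volume (ball (0 : Euc n) 1) =
      ENNReal.ofReal (n * volume.real (ball (0 : Euc n) 1)) := by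
    rw [ENNReal.ofReal_mul hn0.le, measureReal_def, ENNReal.ofReal_toReal measure_ball_lt_top.ne]
    simp
  rw [this, ← ENNReal.ofReal_inv_of_pos (by positivity), ksConst,
    ← ENNReal.ofReal_mul (by positivity)]
  congr 1
  field_simp

/-! ### Weak gradients along segments and difference quotients -/

lemma integrable_comp_add_smul_prod {n : ℕ} {E : Type*} [NormedAddCommGroup E] {H : Euc n → E}
    (hH : StronglyMeasurable H) (hi : Integrable H) (v : Euc n) (s : Set ℝ)
    (hs : volume s ≠ ⊤) :
    Integrable (fun z : Euc n × ℝ => H (z.1 + z.2 • v)) (volume.prod (volume.restrict s)) := by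
  have : IsFiniteMeasure (volume.restrict s : Measure ℝ) := ⟨by simpa using hs.lt_top⟩
  have hm : StronglyMeasurable (fun z : Euc n × ℝ => H (z.1 + z.2 • v)) :=
    hH.comp_measurable (by fun_prop)
  rw [integrable_prod_iff' hm.aestronglyMeasurable]
  refine ⟨ae_of_all _ fun t => hi.comp_add_right (t • v), ?_⟩
  have : ∀ t : ℝ, ∫ x, ‖H (x + t • v)‖ = ∫ x, ‖H x‖ := fun t =>
    integral_add_right_eq_self (fun x => ‖H x‖) (t • v)
  simp only [this]
  exact integrable_const _

lemma sub_eq_neg_integral_fderiv {n : ℕ} {φ : Euc n → ℝ} (hφ : ContDiff ℝ (⊤ : ℕ∞) φ)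
    (y v : Euc n) (h : ℝ) :
    φ (y - h • v) - φ y = -∫ t in 0..h, fderiv ℝ φ (y - t • v) v := by
  have hd : ∀ t ∈ Set.uIcc 0 h, HasDerivAt (fun t : ℝ => φ (y - t • v))
      (-fderiv ℝ φ (y - t • v) v) t := by
    intro t _
    have h1 : HasDerivAt (fun t : ℝ => y - t • v) (-v) t := by
      simpa using ((hasDerivAt_id t).smul_const v).const_sub y
    have h2 := (hφ.differentiable (by simp) (y - t • v)).hasFDerivAt.comp_hasDerivAt t h1
    rw [map_neg] at h2
    exact h2
  have hc : Continuous fun t : ℝ => fderiv ℝ φ (y - t • v) v := by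
    have := hφ.continuous_fderiv (by simp)
    fun_prop
  have := intervalIntegral.integral_eq_sub_of_hasDerivAt hd (hc.neg.intervalIntegrable _ _)
  rw [← intervalIntegral.integral_neg, this]
  simp

/-- A function with a weak gradient is, along almost every segment in a given direction,
the integral of the directional derivative. -/
lemma IsWeakGradient.ae_sub_eq_integral {n : ℕ} {Ω : Set (Euc n)} {f : Euc n → ℝ}
    {G : Euc n → Euc n} (hw : IsWeakGradient Ω f G) (hfm : StronglyMeasurable f)
    (hGm : StronglyMeasurable G) {K U : Set (Euc n)} (hK : IsCompact K) (hKΩ : K ⊆ Ω)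
    (hΩ : IsOpen Ω) (hU : IsOpen U) {v : Euc n} {h : ℝ} (hh : 0 ≤ h)
    (hUK : ∀ x ∈ U, ∀ t ∈ Set.Icc 0 h, x + t • v ∈ K) :
    ∀ᵐ x, x ∈ U → f (x + h • v) - f x = ∫ t in 0..h, inner ℝ v (G (x + t • v)) := by
  have hKm : MeasurableSet K := hK.measurableSet
  -- Truncation to K makes everything globally integrable, so translations and Fubini are free;
  -- segments starting in U stay in K and never see it.
  set F : Euc n → ℝ := K.indicator f with hF
  set H : Euc n → ℝ := K.indicator (fun x => inner ℝ v (G x)) with hH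
  have hFm : StronglyMeasurable F := hfm.indicator hKm
  have hHm : StronglyMeasurable H := (stronglyMeasurable_const.inner hGm).indicator hKm
  have hFi : Integrable F :=
    (hw.locInt.integrableOn_compact_subset hKΩ hK).integrable_indicator hKm
  have hHi : Integrable H := (integrable_indicator_iff hKm).2
    (Integrable.const_inner v (hw.locInt_grad.integrableOn_compact_subset hKΩ hK))
  have hprod := integrable_comp_add_smul_prod hHm hHi v (Set.Ioc 0 h) (by simp)
  have hIi : Integrable (fun x => ∫ t in 0..h, H (x + t • v)) := by
    simp only [intervalIntegral.integral_of_le hh]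
    exact hprod.integral_prod_left
  have hFs : Integrable (fun x => F (x + h • v)) := hFi.comp_add_right _
  -- Fundamental lemma of the calculus of variations: test against φ supported in U, shift the
  -- increment onto φ, and write that increment as an integral of derivatives of translates of φ.
  -- Each translate is supported in K, hence admissible in the definition of the weak gradient.
  have hzero : ∀ᵐ x, x ∈ U → (F (x + h • v) - F x - ∫ t in 0..h, H (x + t • v)) = 0 := by
    refine hU.ae_eq_zero_of_integral_contDiff_smul_eq_zero
      (((hFs.sub hFi).sub hIi).locallyIntegrable.locallyIntegrableOn U) fun φ hφ hφc hφU => ?_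
    have hφcont := hφ.continuous
    obtain ⟨C, hC⟩ := hφcont.bounded_above_of_compact_support hφc
    have hdcont : Continuous fun x => fderiv ℝ φ x v := by
      have := hφ.continuous_fderiv (by simp)
      fun_prop
    obtain ⟨C', hC'⟩ := hdcont.bounded_above_of_compact_support
      (hφc.fderiv_apply (𝕜 := ℝ) v)
    have hmul : ∀ {g : Euc n → ℝ}, Integrable g → ∀ {ψ : Euc n → ℝ}, Continuous ψ →
        (∀ x, ‖ψ x‖ ≤ C) → Integrable (fun x => ψ x * g x) := fun hg ψ hψ hb =>
      hg.bdd_mul hψ.aestronglyMeasurable (ae_of_all _ hb)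
    -- first difference
    have h1 : ∫ x, φ x * (F (x + h • v) - F x) = ∫ y, F y * (φ (y - h • v) - φ y) := by
      have a1 := hmul hFs hφcont hC
      have a2 := hmul hFi hφcont hC
      have a3 := hmul hFi (ψ := fun y => φ (y - h • v)) (by fun_prop) fun x => hC _
      have e1 : ∫ x, φ x * F (x + h • v) = ∫ y, φ (y - h • v) * F y := by
        rw [← integral_add_right_eq_self (fun y => φ (y - h • v) * F y) (h • v)]
        simp
      have e2 : ∫ x, φ x * (F (x + h • v) - F x) =
          (∫ x, φ x * F (x + h • v)) - ∫ x, φ x * F x := by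
        rw [← integral_sub a1 a2]; simp only [mul_sub]
      have e3 : ∫ y, F y * (φ (y - h • v) - φ y) =
          (∫ y, φ (y - h • v) * F y) - ∫ x, φ x * F x := by
        rw [← integral_sub a3 a2]; congr 1; ext y; ring
      rw [e2, e1, e3]
    have h2 : ∫ y, F y * (φ (y - h • v) - φ y) =
        -∫ t in 0..h, ∫ y, F y * fderiv ℝ φ (y - t • v) v := by
      simp only [sub_eq_neg_integral_fderiv hφ, mul_neg, integral_neg,
        intervalIntegral.integral_of_le hh, ← integral_const_mul]
      congr 1
      refine integral_integral_swap ?_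
      have : Integrable (fun z : Euc n × ℝ => F z.1) (volume.prod (volume.restrict (Set.Ioc 0 h))) :=
        hFi.comp_fst _
      exact this.mul_bdd (c := C') (Continuous.aestronglyMeasurable (by fun_prop))
        (ae_of_all _ fun z => hC' _)
    have h3 : ∀ t ∈ Set.Icc 0 h, ∫ y, F y * fderiv ℝ φ (y - t • v) v =
        -∫ x, φ x * H (x + t • v) := by
      intro t ht
      set ψ : Euc n → ℝ := fun y => φ (y - t • v) with hψ
      have hψs : tsupport ψ ⊆ K := by
        intro y hy
        have hy' : y - t • v ∈ tsupport φ :=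
          tsupport_comp_subset_preimage φ (f := fun y => y - t • v) (by fun_prop) hy
        simpa using hUK _ (hφU hy') t ht
      have hψd : ContDiff ℝ (⊤ : ℕ∞) ψ := hφ.comp (contDiff_id.sub contDiff_const)
      have hψc : HasCompactSupport ψ := hK.of_isClosed_subset (isClosed_tsupport _) hψs
      have hfd : ∀ y, fderiv ℝ ψ y v = fderiv ℝ φ (y - t • v) v := by
        intro y; rw [hψ, fderiv_comp_sub]
      have := hw.integral_eq ψ hψd hψc (hψs.trans hKΩ) v
      have e1 : ∫ y, F y * fderiv ℝ φ (y - t • v) v = ∫ x in Ω, f x * fderiv ℝ ψ x v := by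
        rw [← integral_indicator hΩ.measurableSet]
        congr 1; ext y
        rw [← hfd]
        by_cases hy : y ∈ K
        · rw [Set.indicator_of_mem (hKΩ hy), hF, Set.indicator_of_mem hy]
        · have : fderiv ℝ ψ y = 0 := fderiv_of_notMem_tsupport ℝ fun h => hy (hψs h)
          simp [Set.indicator, this]
      have e2 : ∫ x, φ x * H (x + t • v) = ∫ x in Ω, inner ℝ v (G x) * ψ x := by
        rw [← integral_indicator hΩ.measurableSet]
        have : ∫ x, φ x * H (x + t • v) = ∫ y, ψ y * H y := by
          rw [← integral_add_right_eq_self (fun y => ψ y * H y) (t • v)]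
          simp [hψ]
        rw [this]
        congr 1; ext y
        by_cases hy : y ∈ K
        · rw [Set.indicator_of_mem (hKΩ hy), hH, Set.indicator_of_mem hy, mul_comm]
        · have : ψ y = 0 := image_eq_zero_of_notMem_tsupport fun h => hy (hψs h)
          simp [Set.indicator, this]
      rw [e1, this, e2]
    have h4 : ∫ t in 0..h, ∫ x, φ x * H (x + t • v) = ∫ x, φ x * ∫ t in 0..h, H (x + t • v) := by
      simp only [intervalIntegral.integral_of_le hh, ← integral_const_mul]
      refine (integral_integral_swap ?_).symm
      exact hprod.bdd_mul (f := fun z : Euc n × ℝ => φ z.1) (c := C)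
        (Continuous.aestronglyMeasurable (by fun_prop)) (ae_of_all _ fun z => hC _)
    have h5 : ∫ t in 0..h, ∫ y, F y * fderiv ℝ φ (y - t • v) v =
        -∫ t in 0..h, ∫ x, φ x * H (x + t • v) := by
      rw [← intervalIntegral.integral_neg]
      refine intervalIntegral.integral_congr fun t ht => h3 t ?_
      rwa [Set.uIcc_of_le hh] at ht
    have b1 : Integrable fun x => φ x * (F (x + h • v) - F x) := hmul (hFs.sub hFi) hφcont hC
    have b2 := hmul hIi hφcont hC
    have e : ∫ x, φ x • (F (x + h • v) - F x - ∫ t in 0..h, H (x + t • v)) =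
        (∫ x, φ x * (F (x + h • v) - F x)) - ∫ x, φ x * ∫ t in 0..h, H (x + t • v) := by
      rw [← integral_sub b1 b2]; simp only [smul_eq_mul, mul_sub]
    rw [e, h1, h2, h5, h4]; ring
  filter_upwards [hzero] with x hx hxU
  have h0 : x ∈ K := by simpa using hUK x hxU 0 ⟨le_rfl, hh⟩
  have hh' : x + h • v ∈ K := hUK x hxU h ⟨hh, le_rfl⟩
  have := hx hxU
  rw [hF, Set.indicator_of_mem h0, Set.indicator_of_mem hh', sub_eq_zero] at this
  rw [this]
  refine intervalIntegral.integral_congr fun t ht => ?_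
  rw [Set.uIcc_of_le hh] at ht
  simp only [hH, Set.indicator_of_mem (hUK x hxU t ht)]

lemma IsPreconnected.inter_frontier_nonempty_of_isOpen {α : Type*} [TopologicalSpace α]
    {s t : Set α} (hs : IsPreconnected s) (ht : IsOpen t) (h1 : (s ∩ t).Nonempty)
    (h2 : (s ∩ tᶜ).Nonempty) : (s ∩ frontier t).Nonempty := by
  by_contra hcon
  have hd : ∀ x ∈ s, x ∉ frontier t := fun x hx hf => hcon ⟨x, hx, hf⟩
  obtain ⟨y, hys, hyt⟩ := h2
  have hy' : y ∉ closure t := fun hy => hd y hys (by rw [ht.frontier_eq]; exact ⟨hy, hyt⟩)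
  obtain ⟨z, -, hz1, hz2⟩ := hs t (closure t)ᶜ ht isClosed_closure.isOpen_compl
    (fun x hx => by
      by_cases hxt : x ∈ t
      · exact Or.inl hxt
      · exact Or.inr fun hc => hd x hx (by rw [ht.frontier_eq]; exact ⟨hc, hxt⟩))
    h1 ⟨y, hys, hy'⟩
  exact hz2 (subset_closure hz1)

/-- A segment leaving Ω must cross the frontier, at distance at most ‖w‖ ≤ h from x. -/
lemma add_mem_of_mem_innerSet {n : ℕ} {Ω : Set (Euc n)} (hΩ : IsOpen Ω) {h : ℝ} {x w : Euc n}
    (hx : x ∈ innerSet Ω h) (hw : ‖w‖ ≤ h) : x + w ∈ Ω := by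
  by_contra hcon
  have hconn : IsPreconnected (segment ℝ x (x + w)) := (convex_segment _ _).isPreconnected
  obtain ⟨y, hys, hyf⟩ := hconn.inter_frontier_nonempty_of_isOpen hΩ
    ⟨x, left_mem_segment ℝ _ _, hx.1⟩ ⟨x + w, right_mem_segment ℝ _ _, hcon⟩
  have h1 := infDist_le_dist_of_mem (x := x) hyf
  have h2 : dist x y ≤ ‖w‖ := by
    have := (convex_closedBall x ‖w‖).segment_subset (mem_closedBall_self (norm_nonneg w))
      (show x + w ∈ closedBall x ‖w‖ by simp) hys
    rw [dist_comm]; exact this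
  linarith [hx.2]

/-- The distance to the frontier has a positive minimum on K. Boundedness and n > 0 ensure that the
frontier is nonempty; `infDist` to the empty set would be 0. -/
lemma exists_subset_innerSet {n : ℕ} (hn : 0 < n) {Ω : Set (Euc n)} (hΩ : IsOpen Ω)
    (hΩb : Bornology.IsBounded Ω) {K : Set (Euc n)} (hK : IsCompact K) (hKΩ : K ⊆ Ω) :
    ∃ δ > 0, ∀ h < δ, K ⊆ innerSet Ω h := by
  have hn' : Nonempty (Fin n) := ⟨⟨0, hn⟩⟩
  rcases K.eq_empty_or_nonempty with rfl | hne
  · exact ⟨1, one_pos, fun _ _ => Set.empty_subset _⟩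
  have hfr : (frontier Ω).Nonempty := by
    rw [nonempty_frontier_iff]
    refine ⟨hne.mono hKΩ, fun h => ?_⟩
    rw [h] at hΩb
    exact NormedSpace.unbounded_univ ℝ (Euc n) hΩb
  obtain ⟨x, hx, hmin⟩ := hK.exists_isMinOn hne
    (continuous_infDist_pt (frontier Ω)).continuousOn
  refine ⟨infDist x (frontier Ω), ?_, fun h hh y hy => ⟨hKΩ hy, hh.trans_le (hmin hy)⟩⟩
  rw [gt_iff_lt, ← isClosed_frontier.notMem_iff_infDist_pos hfr, hΩ.frontier_eq]
  exact fun h => h.2 (hKΩ hx)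

/-- Continuity of translations in L¹, transported from the continuity of `Lp.compMeasurePreserving`.
-/
lemma tendsto_lintegral_enorm_translate_sub {n : ℕ} {E : Type*} [NormedAddCommGroup E]
    {H : Euc n → E} (hi : Integrable H) :
    Tendsto (fun w : Euc n => ∫⁻ x, ‖H (x + w) - H x‖ₑ) (𝓝 0) (𝓝 0) := by
  have hH : MemLp H 1 (volume : Measure (Euc n)) := memLp_one_iff_integrable.2 hi
  have hmp : ∀ w : Euc n, MeasurePreserving (fun x : Euc n => x + w) := fun w =>
    measurePreserving_add_right _ w
  let g : Euc n → C(Euc n, Euc n) := fun w => ⟨fun x => x + w, by fun_prop⟩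
  have hg : Continuous g := by
    let k : C(Euc n × Euc n, Euc n) := ⟨fun z => z.2 + z.1, by fun_prop⟩
    exact k.curry.continuous
  have hc : Continuous fun w => Lp.compMeasurePreserving (g w) (hmp w) (hH.toLp H) :=
    continuous_const.compMeasurePreservingLp hg hmp ENNReal.one_ne_top
  have h0 := (hc.tendsto 0).edist (tendsto_const_nhds (x := hH.toLp H))
  have e : ∀ w, edist (Lp.compMeasurePreserving (g w) (hmp w) (hH.toLp H)) (hH.toLp H) =
      ∫⁻ x, ‖H (x + w) - H x‖ₑ := by
    intro w
    rw [Lp.toLp_compMeasurePreserving, Lp.edist_toLp_toLp, eLpNorm_one_eq_lintegral_enorm]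
    rfl
  simp only [e] at h0
  simpa using h0

/-- `L¹` convergence of the difference quotients of a function with a weak gradient. -/
lemma IsWeakGradient.tendsto_lintegral_diffQuot {n : ℕ} {Ω : Set (Euc n)} {f : Euc n → ℝ}
    {G : Euc n → Euc n} (hw : IsWeakGradient Ω f G) (hfm : StronglyMeasurable f)
    (hGm : StronglyMeasurable G) {K : Set (Euc n)} (hK : IsCompact K) (hKΩ : K ⊆ Ω)
    (hΩ : IsOpen Ω) {v : Euc n} (hv : ‖v‖ ≤ 1) :
    Tendsto (fun h : ℝ => ∫⁻ x in K, ‖h⁻¹ * (f (x + h • v) - f x) - inner ℝ v (G x)‖ₑ)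
      (𝓝[>] 0) (𝓝 0) := by
  obtain ⟨δ, hδ, hδΩ⟩ := hK.exists_cthickening_subset_open hΩ hKΩ
  set L := cthickening δ K with hL
  have hLc : IsCompact L := hK.cthickening
  have hLm : MeasurableSet L := hLc.measurableSet
  set H : Euc n → ℝ := L.indicator (fun x => inner ℝ v (G x)) with hH
  have hHm : StronglyMeasurable H := (stronglyMeasurable_const.inner hGm).indicator hLm
  have hHi : Integrable H := (integrable_indicator_iff hLm).2
    (Integrable.const_inner v (hw.locInt_grad.integrableOn_compact_subset hδΩ hLc))
  rw [ENNReal.tendsto_nhds_zero]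
  intro ε hε
  have h1 := (tendsto_lintegral_enorm_translate_sub hHi).eventually (Iic_mem_nhds hε)
  obtain ⟨r, hr, hrε⟩ := Metric.eventually_nhds_iff.1 h1
  have hlim : ∀ᶠ h : ℝ in 𝓝[>] 0, h ∈ Set.Ioo 0 (min r (δ / 2)) :=
    Ioo_mem_nhdsGT (lt_min hr (half_pos hδ))
  filter_upwards [hlim] with h hh
  have hh0 : 0 < h := hh.1
  have hhr : h < r := hh.2.trans_le (min_le_left _ _)
  have hhδ : h < δ / 2 := hh.2.trans_le (min_le_right _ _)
  have hnorm : ∀ t ∈ Set.Icc 0 h, ‖t • v‖ ≤ h := by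
    intro t ht
    rw [norm_smul, Real.norm_of_nonneg ht.1]
    exact (mul_le_of_le_one_right ht.1 hv).trans ht.2
  have hUL : ∀ x ∈ thickening (δ / 2) K, ∀ t ∈ Set.Icc 0 h, x + t • v ∈ L := by
    intro x hx t ht
    obtain ⟨z, hz, hxz⟩ := mem_thickening_iff.1 hx
    refine mem_cthickening_of_dist_le _ z _ _ hz ?_
    have := hnorm t ht
    calc dist (x + t • v) z ≤ dist (x + t • v) x + dist x z := dist_triangle _ _ _
      _ ≤ δ := by rw [dist_eq_norm, add_sub_cancel_left]; linarith
  have hKU : K ⊆ thickening (δ / 2) K := self_subset_thickening (half_pos hδ) K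
  have hform := hw.ae_sub_eq_integral hfm hGm hLc hδΩ hΩ isOpen_thickening hh0.le hUL
  have hprod := integrable_comp_add_smul_prod hHm hHi v (Set.Ioc 0 h) (by simp)
  -- The error at x is an average over the segment of H(x+tv) - H(x), so after Tonelli it is
  -- controlled by L¹ norms of small translates.
  have hpt : ∀ᵐ x, x ∈ K → ‖h⁻¹ * (f (x + h • v) - f x) - inner ℝ v (G x)‖ₑ ≤
      (ENNReal.ofReal h)⁻¹ * ∫⁻ t in Set.Ioc 0 h, ‖H (x + t • v) - H x‖ₑ := by
    filter_upwards [hform, hprod.prod_right_ae] with x hx hxi hxK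
    have e1 : ∫ t in 0..h, inner ℝ v (G (x + t • v)) = ∫ t in Set.Ioc 0 h, H (x + t • v) := by
      rw [intervalIntegral.integral_of_le hh0.le]
      refine setIntegral_congr_fun measurableSet_Ioc fun t ht => ?_
      simp only [hH, Set.indicator_of_mem (hUL x (hKU hxK) t ⟨ht.1.le, ht.2⟩)]
    have e2 : inner ℝ v (G x) = H x := by
      have : x ∈ L := by simpa using hUL x (hKU hxK) 0 ⟨le_rfl, hh0.le⟩
      simp only [hH, Set.indicator_of_mem this]
    have e3 : h⁻¹ * (f (x + h • v) - f x) - inner ℝ v (G x) =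
        h⁻¹ * ∫ t in Set.Ioc 0 h, (H (x + t • v) - H x) := by
      rw [hx (hKU hxK), e1, e2, integral_sub hxi (integrable_const _)]
      simp [hh0.le]
      field_simp
    rw [e3, enorm_mul, Real.enorm_of_nonneg (inv_nonneg.2 hh0.le), ENNReal.ofReal_inv_of_pos hh0]
    gcongr
    exact enorm_integral_le_lintegral_enorm _
  calc ∫⁻ x in K, ‖h⁻¹ * (f (x + h • v) - f x) - inner ℝ v (G x)‖ₑ
      ≤ ∫⁻ x in K, (ENNReal.ofReal h)⁻¹ * ∫⁻ t in Set.Ioc 0 h, ‖H (x + t • v) - H x‖ₑ :=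
        lintegral_mono_ae ((ae_restrict_iff' hK.measurableSet).2 hpt)
    _ ≤ ∫⁻ x, (ENNReal.ofReal h)⁻¹ * ∫⁻ t in Set.Ioc 0 h, ‖H (x + t • v) - H x‖ₑ :=
        setLIntegral_le_lintegral _ _
    _ = (ENNReal.ofReal h)⁻¹ * ∫⁻ t in Set.Ioc 0 h, ∫⁻ x, ‖H (x + t • v) - H x‖ₑ := by
        rw [lintegral_const_mul' _ _ (by simp [hh0]), lintegral_lintegral_swap]
        have hm : StronglyMeasurable (fun z : Euc n × ℝ => H (z.1 + z.2 • v) - H z.1) :=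
          (hHm.comp_measurable (by fun_prop)).sub (hHm.comp_measurable measurable_fst)
        exact (StronglyMeasurable.enorm hm).aemeasurable
    _ ≤ (ENNReal.ofReal h)⁻¹ * ∫⁻ t in Set.Ioc 0 h, ε := by
        refine mul_le_mul' le_rfl (setLIntegral_mono' measurableSet_Ioc fun t ht => ?_)
        refine hrε ?_
        rw [dist_zero_right]
        exact (hnorm t ⟨ht.1.le, ht.2⟩).trans_lt hhr
    _ = ε := by
        rw [setLIntegral_const, Real.volume_Ioc, sub_zero, mul_comm ε, ← mul_assoc,
          ENNReal.inv_mul_cancel (by simpa using hh0) ENNReal.ofReal_ne_top, one_mul]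

/-! ### Lower semicontinuity, Jensen, and distances to a dense sequence -/

/-- Lower semicontinuity of weighted `p`-integrals of countable suprema under `L¹` convergence
of every member of the family. -/
lemma lintegral_iSup_rpow_le_liminf {α ι : Type*} [MeasurableSpace α] {μ : Measure α}
    {l : Filter ι} [l.IsCountablyGenerated] {p : ℝ} (hp : 0 ≤ p)
    {A : ℕ → ι → α → ℝ} {B : ℕ → α → ℝ} {W : ι → α → ℝ≥0∞} {w : α → ℝ≥0∞}
    (hAm : ∀ j i, AEMeasurable (A j i) μ) (hBm : ∀ j, AEMeasurable (B j) μ)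
    (hWm : ∀ i, AEMeasurable (W i) μ) (hwm : AEMeasurable w μ) (hw : ∀ x, w x ≠ ⊤)
    (hAB : ∀ j, Tendsto (fun i => ∫⁻ x, ‖A j i x - B j x‖ₑ ∂μ) l (𝓝 0))
    (hAW : ∀ᶠ i in l, ∀ j, ∀ᵐ x ∂μ, ‖A j i x‖ₑ ≤ W i x) :
    ∫⁻ x, w x * (⨆ j, ‖B j x‖ₑ) ^ p ∂μ ≤ liminf (fun i => ∫⁻ x, w x * W i x ^ p ∂μ) l := by
  refine le_of_forall_lt fun b hb => ?_
  obtain ⟨b', hbb', hb'⟩ := exists_between hb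
  refine hbb'.trans_le (le_liminf_of_le (by isBoundedDefault) ?_)
  by_contra hcon
  rw [not_eventually] at hcon
  obtain ⟨s, hs, hsb⟩ := exists_seq_forall_of_frequently (hcon.and_eventually hAW)
  have hdm : ∀ j i, AEMeasurable (fun x => ‖A j i x - B j x‖ₑ) μ := fun j i =>
    ((hAm j i).sub (hBm j)).enorm
  -- Diagonal choice: the N-th index makes the first N errors at most 2⁻ᴺ. The errors of each fixed
  -- j are then summable beyond index j, which gives almost everywhere convergence for all j along
  -- one subsequence.
  have hev : ∀ N : ℕ, ∀ᶠ k in atTop, ∀ j < N,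
      ∫⁻ x, ‖A j (s k) x - B j x‖ₑ ∂μ ≤ (2⁻¹ : ℝ≥0∞) ^ N := by
    intro N
    refine (eventually_all_finite (Set.finite_lt_nat N)).2 fun j _ => ?_
    exact ((hAB j).comp hs).eventually (Iic_mem_nhds (by
      exact ENNReal.pow_pos (by simp) N))
  obtain ⟨φ, -, hφ⟩ := extraction_forall_of_eventually hev
  have hconv : ∀ j, ∀ᵐ x ∂μ, Tendsto (fun k => A j (s (φ k)) x) atTop (𝓝 (B j x)) := by
    intro j
    have hsum : ∑' k, ∫⁻ x, ‖A j (s (φ (k + (j + 1)))) x - B j x‖ₑ ∂μ ≠ ⊤ := by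
      refine ne_top_of_le_ne_top (b := ∑' k, (2⁻¹ : ℝ≥0∞) ^ k) ?_ (ENNReal.tsum_le_tsum fun k => ?_)
      · rw [ENNReal.tsum_geometric]; simp
      · refine (hφ (k + (j + 1)) j (by omega)).trans ?_
        exact pow_le_pow_right_of_le_one' (by simp) (by omega)
    rw [← lintegral_tsum fun k => hdm j _] at hsum
    filter_upwards [ae_lt_top' (AEMeasurable.tsum fun k => hdm j _) hsum] with x hx
    have h0 := ENNReal.tendsto_atTop_zero_of_tsum_ne_top hx.ne
    rw [tendsto_iff_edist_tendsto_0, ← tendsto_add_atTop_iff_nat (j + 1)]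
    simpa only [edist_eq_enorm_sub] using h0
  have hle : ∫⁻ x, w x * (⨆ j, ‖B j x‖ₑ) ^ p ∂μ ≤
      ∫⁻ x, liminf (fun k => w x * W (s (φ k)) x ^ p) atTop ∂μ := by
    refine lintegral_mono_ae ?_
    have hdom : ∀ᵐ x ∂μ, ∀ j k, ‖A j (s (φ k)) x‖ₑ ≤ W (s (φ k)) x :=
      ae_all_iff.2 fun j => ae_all_iff.2 fun k => (hsb (φ k)).2 j
    filter_upwards [ae_all_iff.2 hconv, hdom] with x hx hxd
    have h1 : (⨆ j, ‖B j x‖ₑ) ≤ liminf (fun k => W (s (φ k)) x) atTop := by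
      refine iSup_le fun j => ?_
      rw [← ((hx j).enorm).liminf_eq]
      exact liminf_le_liminf (Eventually.of_forall fun k => hxd j k)
    have hmono : Monotone fun y : ℝ≥0∞ => w x * y ^ p := fun y z hyz => by
      dsimp only; gcongr
    have hcont : Continuous fun y : ℝ≥0∞ => w x * y ^ p :=
      (ENNReal.continuous_const_mul (hw x)).comp ENNReal.continuous_rpow_const
    calc w x * (⨆ j, ‖B j x‖ₑ) ^ p ≤ w x * (liminf (fun k => W (s (φ k)) x) atTop) ^ p := hmono h1
      _ = liminf (fun k => w x * W (s (φ k)) x ^ p) atTop :=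
        hmono.map_liminf_of_continuousAt _ hcont.continuousAt
  have hfatou := lintegral_liminf_le' (μ := μ) (u := atTop)
    (f := fun k x => w x * W (s (φ k)) x ^ p) fun k => hwm.mul ((hWm _).pow_const p)
  have hfin : liminf (fun k => ∫⁻ x, w x * W (s (φ k)) x ^ p ∂μ) atTop ≤ b' :=
    liminf_le_of_frequently_le' (Frequently.of_forall fun k => (not_le.1 (hsb (φ k)).1).le)
  exact absurd (hb'.trans_le (hle.trans (hfatou.trans hfin))) (lt_irrefl _)

/-- Jensen's inequality, as monotonicity of L^p norms for the normalized measure. -/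
lemma lintegral_div_rpow_le {α : Type*} [MeasurableSpace α] {μ : Measure α}
    (h0 : μ Set.univ ≠ 0) (ht : μ Set.univ ≠ ⊤) {p : ℝ} (hp : 1 ≤ p) {φ : α → ℝ≥0∞}
    (hφ : AEMeasurable φ μ) :
    ((∫⁻ x, φ x ∂μ) / μ Set.univ) ^ p ≤ (μ Set.univ)⁻¹ * ∫⁻ x, φ x ^ p ∂μ := by
  have hp0 : 0 < p := by linarith
  have hprob : IsProbabilityMeasure ((μ Set.univ)⁻¹ • μ) :=
    ⟨by simp [ENNReal.inv_mul_cancel h0 ht]⟩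
  have h := eLpNorm'_le_eLpNorm'_of_exponent_le (f := φ) one_pos hp ((μ Set.univ)⁻¹ • μ)
    (hφ.smul_measure _).aestronglyMeasurable
  simp only [eLpNorm'_eq_lintegral_enorm, enorm_eq_self, ENNReal.rpow_one, one_div, inv_one,
    lintegral_smul_measure, smul_eq_mul] at h
  have h2 := ENNReal.rpow_le_rpow h hp0.le
  rwa [← ENNReal.rpow_mul, inv_mul_cancel₀ hp0.ne', ENNReal.rpow_one,
    ← ENNReal.div_eq_inv_mul] at h2

lemma edist_le_iSup_enorm_sub {X : Type*} [MetricSpace X] {ξ : ℕ → X} (hξ : DenseRange ξ)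
    (a b : X) : edist a b ≤ ⨆ j, ‖dist a (ξ j) - dist b (ξ j)‖ₑ := by
  refine ENNReal.le_of_forall_pos_le_add fun ε hε _ => ?_
  -- The distance from b to `ξ j` is paid twice, hence ε / 2.
  obtain ⟨j, hj⟩ := hξ.exists_dist_lt b (show (0 : ℝ) < ε / 2 by positivity)
  have h1 : dist a b ≤ |dist a (ξ j) - dist b (ξ j)| + ε := by
    have := dist_triangle a (ξ j) b
    rw [dist_comm (ξ j) b] at this
    have := le_abs_self (dist a (ξ j) - dist b (ξ j))
    linarith
  calc edist a b = ENNReal.ofReal (dist a b) := edist_dist a b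
    _ ≤ ENNReal.ofReal (|dist a (ξ j) - dist b (ξ j)| + ε) := ENNReal.ofReal_le_ofReal h1
    _ = ‖dist a (ξ j) - dist b (ξ j)‖ₑ + ε := by
      rw [ENNReal.ofReal_add (abs_nonneg (dist a (ξ j) - dist b (ξ j))) ε.coe_nonneg, ← Real.norm_eq_abs,
        ofReal_norm]
      simp
    _ ≤ _ := by gcongr; exact le_iSup (fun j => ‖dist a (ξ j) - dist b (ξ j)‖ₑ) j

lemma enorm_dist_sub_dist_le {X : Type*} [MetricSpace X] (a b c : X) :
    ‖dist a c - dist b c‖ₑ ≤ edist a b := by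
  rw [edist_dist, ← ofReal_norm]
  exact ENNReal.ofReal_le_ofReal (abs_dist_sub_le a b c)

/-- The modulus `sup_j |v · G_j(x)|` of a sequence of gradients. -/
noncomputable def gradSup {n : ℕ} (G : ℕ → Euc n → Euc n) (v x : Euc n) : ℝ≥0∞ :=
  ⨆ j, ‖(inner ℝ v (G j x) : ℝ)‖ₑ

lemma measurable_gradSup {n : ℕ} {G : ℕ → Euc n → Euc n} (hG : ∀ j, StronglyMeasurable (G j)) :
    Measurable (fun z : Euc n × Euc n => gradSup G z.1 z.2) := by
  refine Measurable.iSup fun j => ?_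
  exact (StronglyMeasurable.inner measurable_fst.stronglyMeasurable
    ((hG j).comp_measurable measurable_snd)).enorm

lemma measurable_gradSup_right {n : ℕ} {G : ℕ → Euc n → Euc n}
    (hG : ∀ j, StronglyMeasurable (G j)) (v : Euc n) : Measurable (gradSup G v) :=
  Measurable.iSup fun j => (stronglyMeasurable_const.inner (hG j)).enorm

lemma measurable_gradSup_left {n : ℕ} (G : ℕ → Euc n → Euc n) (x : Euc n) :
    Measurable (fun v => gradSup G v x) :=
  Measurable.iSup fun _ => (Continuous.inner continuous_id continuous_const).measurable.enorm

/-! ### Lower and upper bounds for the approximate energies -/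

/-- The weighted approximate energy without localization. -/
noncomputable def quotEnergy {n : ℕ} {X : Type*} [MetricSpace X] (p : ℝ) (u : Euc n → X)
    (η : Euc n → ℝ) (h : ℝ) (v : Euc n) : ℝ≥0∞ :=
  ∫⁻ x, ENNReal.ofReal (η x) * (edist (u x) (u (x + h • v)) / ENNReal.ofReal h) ^ p

lemma measurable_edist_translate {n : ℕ} {X : Type*} [MetricSpace X] {u : Euc n → X}
    (hu : StronglyMeasurable u) (h : ℝ) :
    Measurable (fun z : Euc n × Euc n => edist (u z.1) (u (z.1 + h • z.2))) :=
  (StronglyMeasurable.edist (hu.comp_measurable measurable_fst)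
    (hu.comp_measurable (g := fun z : Euc n × Euc n => z.1 + h • z.2) (by fun_prop))).measurable

/-- Once the support of η lies in Ω_h the localization is invisible, and Tonelli reduces the
analysis to one direction v at a time. -/
lemma lintegral_approxEnergy_eq {n : ℕ} {X : Type*} [MetricSpace X] {Ω : Set (Euc n)} {p : ℝ}
    (hp : 0 ≤ p) {u : Euc n → X} (hu : StronglyMeasurable u) {η : Euc n → ℝ}
    (hη : IsNonnegCc Ω η) (hΩ : IsOpen Ω) {h : ℝ} (hs : tsupport η ⊆ innerSet Ω h) :
    ∫⁻ x in Ω, approxEnergy Ω p u h x * ENNReal.ofReal (η x) =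
      ksConst n p * ∫⁻ v in ball (0 : Euc n) 1, quotEnergy p u η h v := by
  have hηm : Measurable η := hη.continuous.measurable
  have hm := measurable_edist_translate hu h
  have e1 : ∀ x, Ω.indicator (fun x => approxEnergy Ω p u h x * ENNReal.ofReal (η x)) x =
      ksConst n p * ∫⁻ v in ball (0 : Euc n) 1,
        ENNReal.ofReal (η x) * (edist (u x) (u (x + h • v)) / ENNReal.ofReal h) ^ p := by
    intro x
    by_cases hx : x ∈ tsupport η
    · rw [Set.indicator_of_mem (hη.support hx), approxEnergy, if_pos (hs hx), mul_assoc, mul_comm _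
        (ENNReal.ofReal (η x)), lintegral_const_mul' _ _ ENNReal.ofReal_ne_top]
      simp only [ENNReal.div_rpow_of_nonneg _ _ hp]
    · have : η x = 0 := image_eq_zero_of_notMem_tsupport hx
      simp [Set.indicator, this]
  rw [← lintegral_indicator hΩ.measurableSet]
  simp only [e1, quotEnergy]
  have hjoint : Measurable (fun z : Euc n × Euc n => ENNReal.ofReal (η z.1) *
      (edist (u z.1) (u (z.1 + h • z.2)) / ENNReal.ofReal h) ^ p) :=
    (hηm.comp measurable_fst).ennreal_ofReal.mul ((hm.div_const _).pow_const p)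
  rw [lintegral_const_mul, lintegral_lintegral_swap]
  · exact hjoint.aemeasurable
  · exact hjoint.lintegral_prod_right'

lemma eventually_lintegral_approxEnergy_eq {n : ℕ} (hn : 0 < n) {X : Type*} [MetricSpace X]
    {Ω : Set (Euc n)} (hΩ : IsOpen Ω) (hΩb : Bornology.IsBounded Ω) {p : ℝ}
    (hp : 0 ≤ p) {u : Euc n → X} (hu : StronglyMeasurable u) {η : Euc n → ℝ}
    (hη : IsNonnegCc Ω η) :
    (fun h => ∫⁻ x in Ω, approxEnergy Ω p u h x * ENNReal.ofReal (η x)) =ᶠ[𝓝[>] 0]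
      fun h => ksConst n p * ∫⁻ v in ball (0 : Euc n) 1, quotEnergy p u η h v := by
  obtain ⟨δ, hδ, hsub⟩ := exists_subset_innerSet hn hΩ hΩb hη.compact hη.support
  filter_upwards [Ioo_mem_nhdsGT hδ] with h hh
  exact lintegral_approxEnergy_eq hp hu hη hΩ (hsub h hh.2)

lemma measurable_quotEnergy {n : ℕ} {X : Type*} [MetricSpace X] {p : ℝ} {u : Euc n → X}
    (hu : StronglyMeasurable u) {η : Euc n → ℝ} (hη : Measurable η) (h : ℝ) :
    Measurable (quotEnergy p u η h) := by
  have hm := measurable_edist_translate hu h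
  have hjoint : Measurable (fun z : Euc n × Euc n => ENNReal.ofReal (η z.1) *
      (edist (u z.1) (u (z.1 + h • z.2)) / ENNReal.ofReal h) ^ p) :=
    (hη.comp measurable_fst).ennreal_ofReal.mul ((hm.div_const _).pow_const p)
  exact hjoint.lintegral_prod_left'

lemma ksConst_ne_top (n : ℕ) (p : ℝ) : ksConst n p ≠ ⊤ := ENNReal.ofReal_ne_top

/-- The lower bound in a fixed direction: the reverse triangle inequality dominates the difference
quotients of every d(u, ξ_j) by the metric quotient. Density of the ξ_j plays no role. -/
lemma lintegral_gradSup_le_liminf_quotEnergy {n : ℕ} {X : Type*} [MetricSpace X]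
    {Ω : Set (Euc n)} (hΩ : IsOpen Ω) {p : ℝ} (hp : 0 ≤ p) {u : Euc n → X}
    (hu : StronglyMeasurable u) {ξ : ℕ → X} {G : ℕ → Euc n → Euc n}
    (hG : ∀ j, StronglyMeasurable (G j))
    (hw : ∀ j, IsWeakGradient Ω (fun x => dist (u x) (ξ j)) (G j)) {η : Euc n → ℝ}
    (hη : IsNonnegCc Ω η) {v : Euc n} (hv : ‖v‖ ≤ 1) :
    ∫⁻ x, ENNReal.ofReal (η x) * gradSup G v x ^ p ≤
      liminf (fun h => quotEnergy p u η h v) (𝓝[>] 0) := by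
  have hηm : Measurable η := hη.continuous.measurable
  set K := tsupport η
  have hK : IsCompact K := hη.compact
  have hres : ∀ φ : Euc n → ℝ≥0∞, ∫⁻ x, ENNReal.ofReal (η x) * φ x =
      ∫⁻ x in K, ENNReal.ofReal (η x) * φ x := by
    intro φ
    rw [← lintegral_indicator hK.measurableSet]
    refine lintegral_congr fun x => ?_
    by_cases hx : x ∈ K
    · rw [Set.indicator_of_mem hx]
    · rw [Set.indicator_of_notMem hx, image_eq_zero_of_notMem_tsupport hx]; simp
  have hf : ∀ j, StronglyMeasurable (fun x => dist (u x) (ξ j)) := fun j =>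
    hu.dist stronglyMeasurable_const
  simp only [quotEnergy, hres]
  refine lintegral_iSup_rpow_le_liminf (l := 𝓝[>] (0 : ℝ)) hp
    (A := fun j h x => h⁻¹ * (dist (u (x + h • v)) (ξ j) - dist (u x) (ξ j)))
    (fun j h => ?_) (fun j => ?_) (fun h => ?_) hηm.ennreal_ofReal.aemeasurable
    (fun x => ENNReal.ofReal_ne_top)
    (fun j => (hw j).tendsto_lintegral_diffQuot (hf j) (hG j) hK hη.support hΩ hv) ?_
  · exact ((((hf j).comp_measurable (measurable_add_const (h • v))).sub
      (hf j)).const_mul h⁻¹).measurable.aemeasurable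
  · exact (stronglyMeasurable_const.inner (hG j)).measurable.aemeasurable
  · have : Measurable (fun x => edist (u x) (u (x + h • v))) :=
      (StronglyMeasurable.edist hu (hu.comp_measurable (measurable_add_const (h • v)))).measurable
    exact (this.div_const _).aemeasurable
  · filter_upwards [self_mem_nhdsWithin] with h hh j
    refine ae_of_all _ fun x => ?_
    have hh0 : (0 : ℝ) < h := hh
    rw [enorm_mul, Real.enorm_of_nonneg (inv_nonneg.2 hh0.le), ENNReal.ofReal_inv_of_pos hh0,
      ENNReal.div_eq_inv_mul, edist_comm]
    gcongr
    exact enorm_dist_sub_dist_le _ _ _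

/-- The lower bound for the approximate energies. -/
lemma lintegral_gradSup_le_liminf {n : ℕ} {X : Type*} [MetricSpace X]
    {Ω : Set (Euc n)} (hΩ : IsOpen Ω) {p : ℝ} (hp : 0 ≤ p) {u : Euc n → X}
    (hu : StronglyMeasurable u) {ξ : ℕ → X} {G : ℕ → Euc n → Euc n}
    (hG : ∀ j, StronglyMeasurable (G j))
    (hw : ∀ j, IsWeakGradient Ω (fun x => dist (u x) (ξ j)) (G j)) {η : Euc n → ℝ}
    (hη : IsNonnegCc Ω η) :
    ∫⁻ x, ENNReal.ofReal (η x) * (ksConst n p * ∫⁻ v in ball (0 : Euc n) 1, gradSup G v x ^ p) ≤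
      liminf (fun h => ksConst n p * ∫⁻ v in ball (0 : Euc n) 1, quotEnergy p u η h v)
        (𝓝[>] 0) := by
  have hηm : Measurable η := hη.continuous.measurable
  have hgm := measurable_gradSup hG
  have hjoint : Measurable (fun z : Euc n × Euc n =>
      ENNReal.ofReal (η z.1) * gradSup G z.2 z.1 ^ p) :=
    (hηm.comp measurable_fst).ennreal_ofReal.mul ((hgm.comp measurable_swap).pow_const p)
  have hcont : Continuous fun y : ℝ≥0∞ => ksConst n p * y :=
    ENNReal.continuous_const_mul (ksConst_ne_top n p)
  have hmono : Monotone fun y : ℝ≥0∞ => ksConst n p * y := fun y z hyz => by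
    dsimp only; gcongr
  calc ∫⁻ x, ENNReal.ofReal (η x) * (ksConst n p * ∫⁻ v in ball (0 : Euc n) 1, gradSup G v x ^ p)
      = ∫⁻ x, ksConst n p * ∫⁻ v in ball (0 : Euc n) 1,
          ENNReal.ofReal (η x) * gradSup G v x ^ p := by
        refine lintegral_congr fun x => ?_
        rw [lintegral_const_mul' _ _ ENNReal.ofReal_ne_top]; ring
    _ = ksConst n p * ∫⁻ v in ball (0 : Euc n) 1, ∫⁻ x, ENNReal.ofReal (η x) *
          gradSup G v x ^ p := by
        rw [lintegral_const_mul _ hjoint.lintegral_prod_right',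
          lintegral_lintegral_swap hjoint.aemeasurable]
    _ ≤ ksConst n p * ∫⁻ v in ball (0 : Euc n) 1,
          liminf (fun h => quotEnergy p u η h v) (𝓝[>] 0) := by
        refine mul_le_mul' le_rfl (setLIntegral_mono' measurableSet_ball fun v hv => ?_)
        exact lintegral_gradSup_le_liminf_quotEnergy hΩ hp hu hG hw hη
          (by simpa using (mem_ball_zero_iff.1 hv).le)
    _ ≤ ksConst n p * liminf (fun h => ∫⁻ v in ball (0 : Euc n) 1, quotEnergy p u η h v)
          (𝓝[>] 0) := by
        gcongr
        -- Second use of Fatou, now in the direction v.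
        exact lintegral_liminf_le fun h => measurable_quotEnergy hu hηm h
    _ = _ := hmono.map_liminf_of_continuousAt _ hcont.continuousAt

/-- A countable family has a common null set off which every d(u, ξ_j) is integrated along the
segment; the supremum over j recovers the distance by density. -/
lemma edist_translate_le_lintegral_gradSup {n : ℕ} {X : Type*} [MetricSpace X]
    {Ω : Set (Euc n)} (hΩ : IsOpen Ω) {u : Euc n → X}
    (hu : StronglyMeasurable u) {ξ : ℕ → X} (hξ : DenseRange ξ) {G : ℕ → Euc n → Euc n}
    (hG : ∀ j, StronglyMeasurable (G j))
    (hw : ∀ j, IsWeakGradient Ω (fun x => dist (u x) (ξ j)) (G j)) {L U : Set (Euc n)}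
    (hL : IsCompact L) (hLΩ : L ⊆ Ω) (hU : IsOpen U) {v : Euc n} {h : ℝ} (hh : 0 ≤ h)
    (hUL : ∀ x ∈ U, ∀ t ∈ Set.Icc 0 h, x + t • v ∈ L) :
    ∀ᵐ x, x ∈ U → edist (u x) (u (x + h • v)) ≤ ∫⁻ t in Set.Ioc 0 h, gradSup G v (x + t • v) := by
  have hf : ∀ j, StronglyMeasurable (fun x => dist (u x) (ξ j)) := fun j =>
    hu.dist stronglyMeasurable_const
  have hall := ae_all_iff.2 fun j =>
    (hw j).ae_sub_eq_integral (hf j) (hG j) hL hLΩ hΩ hU hh hUL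
  filter_upwards [hall] with x hx hxU
  rw [edist_comm]
  refine (edist_le_iSup_enorm_sub hξ _ _).trans (iSup_le fun j => ?_)
  rw [hx j hxU, intervalIntegral.integral_of_le hh]
  refine (enorm_integral_le_lintegral_enorm _).trans (lintegral_mono fun t => ?_)
  exact le_iSup (fun j => ‖(inner ℝ v (G j (x + t • v)) : ℝ)‖ₑ) j

/-- Jensen on the segment turns the p-th power of the average into an average of p-th powers;
substituting y = x + tv moves the shift onto the weight, where it costs ε. -/
lemma quotEnergy_le_lintegral_gradSup {n : ℕ} {X : Type*} [MetricSpace X]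
    {Ω : Set (Euc n)} (hΩ : IsOpen Ω) {p : ℝ} (hp : 1 ≤ p) {u : Euc n → X}
    (hu : StronglyMeasurable u) {ξ : ℕ → X} (hξ : DenseRange ξ) {G : ℕ → Euc n → Euc n}
    (hG : ∀ j, StronglyMeasurable (G j))
    (hw : ∀ j, IsWeakGradient Ω (fun x => dist (u x) (ξ j)) (G j))
    {η : Euc n → ℝ} (hη : IsNonnegCc Ω η) {L U : Set (Euc n)}
    (hLc : IsCompact L) (hLΩ : L ⊆ Ω) (hU : IsOpen U) (hKU : tsupport η ⊆ U) {v : Euc n}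
    {h ε : ℝ} (hh0 : 0 < h) (hε : 0 < ε)
    (hUL : ∀ x ∈ U, ∀ t ∈ Set.Icc 0 h, x + t • v ∈ L)
    (hηε : ∀ t ∈ Set.Icc 0 h, ∀ y, η (y - t • v) ≤ η y + ε) :
    quotEnergy p u η h v ≤
      ∫⁻ x, (Ω.indicator fun x => ENNReal.ofReal (η x) + ENNReal.ofReal ε) x *
        gradSup G v x ^ p := by
  have hηm : Measurable η := hη.continuous.measurable
  have hgv : Measurable (gradSup G v) := measurable_gradSup_right hG v
  set K := tsupport η
  have hH0 : ENNReal.ofReal h ≠ 0 := by simpa using hh0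
  set θ : Euc n → ℝ≥0∞ := Ω.indicator fun x => ENNReal.ofReal (η x) + ENNReal.ofReal ε with hθ
  have hae := edist_translate_le_lintegral_gradSup hΩ hu hξ hG hw hLc hLΩ hU hh0.le hUL
  have hshift : Measurable (fun z : Euc n × ℝ => gradSup G v (z.1 + z.2 • v)) :=
    hgv.comp
      (show Measurable (fun z : Euc n × ℝ => z.1 + z.2 • v) by fun_prop)
  have hshiftη : Measurable (fun z : Euc n × ℝ => ENNReal.ofReal (η z.1) *
      gradSup G v (z.1 + z.2 • v) ^ p) :=
    (hηm.comp measurable_fst).ennreal_ofReal.mul (hshift.pow_const p)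
  calc quotEnergy p u η h v
      ≤ ∫⁻ x, (ENNReal.ofReal h)⁻¹ * ∫⁻ t in Set.Ioc 0 h,
          ENNReal.ofReal (η x) * gradSup G v (x + t • v) ^ p := by
        refine lintegral_mono_ae ?_
        filter_upwards [hae] with x hx
        by_cases hxK : x ∈ K
        · rw [lintegral_const_mul' _ _ ENNReal.ofReal_ne_top, mul_left_comm]
          gcongr
          have hJ := lintegral_div_rpow_le (μ := volume.restrict (Set.Ioc 0 h))
            (φ := fun t => gradSup G v (x + t • v)) (by simpa using hh0) (by simp) hp
            (hshift.comp measurable_prodMk_left).aemeasurable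
          simp only [Measure.restrict_apply_univ, Real.volume_Ioc, sub_zero] at hJ
          refine le_trans ?_ hJ
          gcongr
          exact hx (hKU hxK)
        · rw [image_eq_zero_of_notMem_tsupport hxK]; simp
    _ = (ENNReal.ofReal h)⁻¹ * ∫⁻ t in Set.Ioc 0 h, ∫⁻ x,
          ENNReal.ofReal (η x) * gradSup G v (x + t • v) ^ p := by
        rw [lintegral_const_mul' _ _ (ENNReal.inv_ne_top.2 hH0),
          lintegral_lintegral_swap hshiftη.aemeasurable]
    _ ≤ (ENNReal.ofReal h)⁻¹ * ∫⁻ t in Set.Ioc 0 h, ∫⁻ x, θ x * gradSup G v x ^ p := by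
        refine mul_le_mul' le_rfl (setLIntegral_mono' measurableSet_Ioc fun t ht => ?_)
        have ht' : t ∈ Set.Icc 0 h := ⟨ht.1.le, ht.2⟩
        have e := lintegral_add_right_eq_self (μ := (volume : Measure (Euc n)))
          (fun y => ENNReal.ofReal (η (y - t • v)) * gradSup G v y ^ p) (t • v)
        simp only [add_sub_cancel_right] at e
        rw [e]
        refine lintegral_mono fun y => mul_le_mul' ?_ le_rfl
        by_cases hy : y ∈ Ω
        · rw [hθ, Set.indicator_of_mem hy, ← ENNReal.ofReal_add (hη.nonneg y) hε.le]
          exact ENNReal.ofReal_le_ofReal (hηε t ht' y)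
        -- Off Ω the shifted weight vanishes, which is why the error ε may be cut off to Ω.
        · have : y - t • v ∉ K := fun hk => by
            have := hUL _ (hKU hk) t ht'
            rw [sub_add_cancel] at this
            exact hy (hLΩ this)
          rw [image_eq_zero_of_notMem_tsupport this]; simp
    _ = ∫⁻ x, θ x * gradSup G v x ^ p := by
        rw [setLIntegral_const, Real.volume_Ioc, sub_zero, mul_comm _ (ENNReal.ofReal h),
          ← mul_assoc, ENNReal.inv_mul_cancel hH0 ENNReal.ofReal_ne_top, one_mul]

/-- The upper bound for the approximate energies. -/
lemma limsup_quotEnergy_le {n : ℕ} {X : Type*} [MetricSpace X]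
    {Ω : Set (Euc n)} (hΩ : IsOpen Ω) {p : ℝ} (hp : 1 ≤ p) {u : Euc n → X}
    (hu : StronglyMeasurable u) {ξ : ℕ → X} (hξ : DenseRange ξ) {G : ℕ → Euc n → Euc n}
    (hG : ∀ j, StronglyMeasurable (G j))
    (hw : ∀ j, IsWeakGradient Ω (fun x => dist (u x) (ξ j)) (G j))
    (hfin : ∫⁻ x in Ω, ksConst n p * ∫⁻ v in ball (0 : Euc n) 1, gradSup G v x ^ p ≠ ⊤)
    {η : Euc n → ℝ} (hη : IsNonnegCc Ω η) :
    limsup (fun h => ksConst n p * ∫⁻ v in ball (0 : Euc n) 1, quotEnergy p u η h v) (𝓝[>] 0) ≤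
      ∫⁻ x, ENNReal.ofReal (η x) *
        (ksConst n p * ∫⁻ v in ball (0 : Euc n) 1, gradSup G v x ^ p) := by
  have hp0 : 0 ≤ p := by linarith
  have hηm : Measurable η := hη.continuous.measurable
  have hgm := measurable_gradSup hG
  obtain ⟨δ, hδ, hδΩ⟩ := hη.compact.exists_cthickening_subset_open hΩ hη.support
  set K := tsupport η
  set L := cthickening δ K with hL
  have hLc : IsCompact L := hη.compact.cthickening
  have hKU : K ⊆ thickening (δ / 2) K := self_subset_thickening (half_pos hδ) K
  set Γ : Euc n → ℝ≥0∞ := fun x => ksConst n p * ∫⁻ v in ball (0 : Euc n) 1, gradSup G v x ^ p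
    with hΓ
  have hjoint0 : Measurable (fun z : Euc n × Euc n => gradSup G z.2 z.1 ^ p) :=
    (hgm.comp measurable_swap).pow_const p
  have hΓm : Measurable Γ := hjoint0.lintegral_prod_right'.const_mul _
  have main : ∀ ε : ℝ, 0 < ε → ∀ᶠ h in 𝓝[>] (0 : ℝ),
      ksConst n p * ∫⁻ v in ball (0 : Euc n) 1, quotEnergy p u η h v ≤
        (∫⁻ x, ENNReal.ofReal (η x) * Γ x) + ENNReal.ofReal ε * ∫⁻ x in Ω, Γ x := by
    intro ε hε
    have huc := hη.compact.uniformContinuous_of_continuous hη.continuous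
    obtain ⟨r, hr, hrε⟩ := Metric.uniformContinuous_iff.1 huc ε hε
    filter_upwards [Ioo_mem_nhdsGT (lt_min hr (half_pos hδ))] with h hh
    have hh0 : 0 < h := hh.1
    have hhr : h < r := hh.2.trans_le (min_le_left _ _)
    have hhδ : h < δ / 2 := hh.2.trans_le (min_le_right _ _)
    set θ : Euc n → ℝ≥0∞ := Ω.indicator fun x => ENNReal.ofReal (η x) + ENNReal.ofReal ε with hθ
    have hθm : Measurable θ :=
      (hηm.ennreal_ofReal.add measurable_const).indicator hΩ.measurableSet
    have hstep : ∀ v ∈ ball (0 : Euc n) 1,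
        quotEnergy p u η h v ≤ ∫⁻ x, θ x * gradSup G v x ^ p := by
      intro v hv
      have hv1 : ‖v‖ ≤ 1 := (mem_ball_zero_iff.1 hv).le
      have hnorm : ∀ t ∈ Set.Icc 0 h, ‖t • v‖ ≤ h := by
        intro t ht
        rw [norm_smul, Real.norm_of_nonneg ht.1]
        exact (mul_le_of_le_one_right ht.1 hv1).trans ht.2
      have hUL : ∀ x ∈ thickening (δ / 2) K, ∀ t ∈ Set.Icc 0 h, x + t • v ∈ L := by
        intro x hx t ht
        obtain ⟨z, hz, hxz⟩ := mem_thickening_iff.1 hx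
        refine mem_cthickening_of_dist_le _ z _ _ hz ?_
        have := hnorm t ht
        calc dist (x + t • v) z ≤ dist (x + t • v) x + dist x z := dist_triangle _ _ _
          _ ≤ δ := by rw [dist_eq_norm, add_sub_cancel_left]; linarith
      refine quotEnergy_le_lintegral_gradSup hΩ hp hu hξ hG hw hη hLc hδΩ isOpen_thickening hKU
        hh0 hε hUL fun t ht y => ?_
      have hd := hrε (a := y - t • v) (b := y) (by
        rw [dist_eq_norm, sub_sub_cancel_left, norm_neg]
        exact (hnorm t ht).trans_lt hhr)
      rw [Real.dist_eq] at hd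
      linarith [(abs_lt.1 hd).2]
    have hjoint : Measurable (fun z : Euc n × Euc n => θ z.1 * gradSup G z.2 z.1 ^ p) :=
      (hθm.comp measurable_fst).mul hjoint0
    calc ksConst n p * ∫⁻ v in ball (0 : Euc n) 1, quotEnergy p u η h v
        ≤ ksConst n p * ∫⁻ v in ball (0 : Euc n) 1, ∫⁻ x, θ x * gradSup G v x ^ p :=
          mul_le_mul' le_rfl (setLIntegral_mono' measurableSet_ball hstep)
      _ = ∫⁻ x, θ x * Γ x := by
          rw [← lintegral_lintegral_swap hjoint.aemeasurable, ← lintegral_const_mul _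
            hjoint.lintegral_prod_right']
          refine lintegral_congr fun x => ?_
          have hm : Measurable fun v => gradSup G v x ^ p :=
            (measurable_gradSup_left G x).pow_const p
          change ksConst n p * ∫⁻ v in ball (0 : Euc n) 1, θ x * gradSup G v x ^ p = θ x * Γ x
          rw [lintegral_const_mul _ hm, mul_left_comm]
      _ = ∫⁻ x in Ω, (ENNReal.ofReal (η x) * Γ x + ENNReal.ofReal ε * Γ x) := by
          rw [← lintegral_indicator hΩ.measurableSet]
          refine lintegral_congr fun x => ?_
          by_cases hx : x ∈ Ω
          · simp only [hθ, Set.indicator_of_mem hx]; ring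
          · simp only [hθ, Set.indicator_of_notMem hx, zero_mul]
      _ ≤ _ := by
          have hm : Measurable fun x => ENNReal.ofReal (η x) * Γ x := hηm.ennreal_ofReal.mul hΓm
          rw [lintegral_add_left hm, lintegral_const_mul _ hΓm]
          gcongr
          exact Measure.restrict_le_self
  -- Integrability of Γ on Ω is what makes the error term vanish as ε → 0.
  have hlim : Tendsto (fun ε : ℝ => (∫⁻ x, ENNReal.ofReal (η x) * Γ x) +
      ENNReal.ofReal ε * ∫⁻ x in Ω, Γ x) (𝓝[>] 0) (𝓝 (∫⁻ x, ENNReal.ofReal (η x) * Γ x)) := by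
    have h1 : Tendsto (fun ε : ℝ => ENNReal.ofReal ε) (𝓝[>] 0) (𝓝 0) := by
      have := (ENNReal.continuous_ofReal.tendsto 0).mono_left (nhdsWithin_le_nhds (s := Set.Ioi 0))
      simpa using this
    have h2 := ENNReal.Tendsto.mul_const h1 (Or.inr hfin)
    simpa using tendsto_const_nhds.add h2
  refine ge_of_tendsto hlim ?_
  filter_upwards [self_mem_nhdsWithin] with ε hε
  exact limsup_le_of_le (by isBoundedDefault) (main ε hε)

/-! ### Functionals bounded in an L^q norm have densities -/

/-- Bounded measurable real functions. -/
def boundedMeasurable (α : Type*) [MeasurableSpace α] : Submodule ℝ (α → ℝ) where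
  carrier := {f | Measurable f ∧ ∃ C, ∀ x, |f x| ≤ C}
  add_mem' := by
    rintro f g ⟨hf, C, hC⟩ ⟨hg, D, hD⟩
    exact ⟨hf.add hg, C + D, fun x => (abs_add_le _ _).trans (add_le_add (hC x) (hD x))⟩
  zero_mem' := ⟨measurable_const, 0, fun x => by simp⟩
  smul_mem' := by
    rintro c f ⟨hf, C, hC⟩
    refine ⟨hf.const_smul c, |c| * C, fun x => ?_⟩
    simp only [Pi.smul_apply, smul_eq_mul, abs_mul]
    exact mul_le_mul_of_nonneg_left (hC x) (abs_nonneg c)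

lemma memLp_of_mem_boundedMeasurable {α : Type*} [MeasurableSpace α] {m : Measure α}
    [IsFiniteMeasure m] {f : α → ℝ} (hf : f ∈ boundedMeasurable α) (q : ℝ≥0∞) : MemLp f q m := by
  obtain ⟨hm, C, hC⟩ := hf
  exact MemLp.of_bound hm.aestronglyMeasurable C (ae_of_all _ hC)

lemma indicator_mem_boundedMeasurable {α : Type*} [MeasurableSpace α] {s : Set α}
    (hs : MeasurableSet s) : s.indicator (fun _ => (1 : ℝ)) ∈ boundedMeasurable α :=
  ⟨measurable_const.indicator hs, 1, fun x => by
    by_cases hx : x ∈ s <;> simp [hx]⟩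

/-- A linear functional on bounded measurable functions which is bounded in an `L^q` norm,
`q < ∞`, of a finite measure is given by an integrable density. -/
lemma exists_density_of_bounded {α : Type*} [MeasurableSpace α] (m : Measure α)
    [IsFiniteMeasure m] {q : ℝ≥0∞} (hq0 : q ≠ 0) (hq : q ≠ ⊤)
    (Φ : boundedMeasurable α →ₗ[ℝ] ℝ) {C : ℝ}
    (hΦ : ∀ f, |Φ f| ≤ C * (eLpNorm (f : α → ℝ) q m).toReal) :
    ∃ g : α → ℝ, Integrable g m ∧ ∀ f, Φ f = ∫ x, (f : α → ℝ) x * g x ∂m := by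
  classical
  let I : {s : Set α // MeasurableSet s} → boundedMeasurable α := fun s =>
    ⟨s.1.indicator (fun _ => (1 : ℝ)), indicator_mem_boundedMeasurable s.2⟩
  -- This estimate on indicators drives the construction: since 1/q > 0, small sets have small Φ. It
  -- yields both the countable additivity of s ↦ Φ(1_s) and its absolute continuity.
  have hI : ∀ s : {s : Set α // MeasurableSet s}, |Φ (I s)| ≤ C * (m.real s.1) ^ (1 / q.toReal) := by
    intro s
    refine (hΦ _).trans (le_of_eq ?_)
    have : eLpNorm (I s : α → ℝ) q m = m s.1 ^ (1 / q.toReal) := by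
      change eLpNorm (s.1.indicator fun _ => (1 : ℝ)) q m = _
      rw [eLpNorm_indicator_const s.2 hq0 hq]; simp
    rw [this, ← ENNReal.toReal_rpow]; rfl
  have hqpos : 0 < 1 / q.toReal := one_div_pos.2 (ENNReal.toReal_pos hq0 hq)
  let S : SignedMeasure α :=
    { measureOf' := fun s => if hs : MeasurableSet s then Φ (I ⟨s, hs⟩) else 0
      empty' := by
        have : I ⟨∅, MeasurableSet.empty⟩ = 0 := by ext x; simp [I]
        rw [dif_pos MeasurableSet.empty]
        exact (congrArg Φ this).trans (map_zero Φ)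
      not_measurable' := fun s hs => by simp [hs]
      m_iUnion' := by
        intro A hA hd
        have hU : MeasurableSet (⋃ i, A i) := MeasurableSet.iUnion hA
        simp only [hA, hU, dif_pos]
        have hm := m.toSignedMeasure.m_iUnion hA hd
        simp only [Measure.toSignedMeasure_apply_measurable (hA _),
          Measure.toSignedMeasure_apply_measurable hU] at hm
        have hbound : ∀ F : Finset ℕ, |∑ i ∈ F, Φ (I ⟨A i, hA i⟩) - Φ (I ⟨⋃ i, A i, hU⟩)| ≤
            C * (m.real (⋃ i, A i) - ∑ i ∈ F, m.real (A i)) ^ (1 / q.toReal) := by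
          intro F
          have hF : MeasurableSet (⋃ i ∈ F, A i) := F.measurableSet_biUnion fun i _ => hA i
          have hsub : (⋃ i ∈ F, A i) ⊆ ⋃ i, A i := Set.iUnion₂_subset_iUnion _ _
          have e1 : I ⟨⋃ i, A i, hU⟩ - ∑ i ∈ F, I ⟨A i, hA i⟩ =
              I ⟨(⋃ i, A i) \ ⋃ i ∈ F, A i, hU.diff hF⟩ := by
            ext x
            have h2 := Finset.indicator_biUnion_apply F A
              (fun i _ j _ hij => hd hij) (f := fun _ : α => (1 : ℝ)) x
            have h1 := congrFun (Set.indicator_sdiff hsub (fun _ : α => (1 : ℝ))) x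
            simp only [Pi.sub_apply] at h1
            simp only [I, Submodule.coe_sub, AddSubmonoidClass.coe_finsetSum, Pi.sub_apply,
              Finset.sum_apply]
            rw [h1, h2]
          have e2 : m.real ((⋃ i, A i) \ ⋃ i ∈ F, A i) =
              m.real (⋃ i, A i) - ∑ i ∈ F, m.real (A i) := by
            rw [measureReal_sdiff hsub hF, measureReal_biUnion_finset
              (fun i _ j _ hij => hd hij) fun i _ => hA i]
          rw [← map_sum, abs_sub_comm, ← map_sub, e1, ← e2]
          exact hI _
        rw [HasSum, SummationFilter.unconditional_filter, tendsto_iff_dist_tendsto_zero]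
        refine squeeze_zero (fun _ => dist_nonneg) (fun F => ?_)
          (g := fun F : Finset ℕ =>
            C * (m.real (⋃ i, A i) - ∑ i ∈ F, m.real (A i)) ^ (1 / q.toReal)) ?_
        · rw [Real.dist_eq]; exact hbound F
        · have h1 : Tendsto (fun F : Finset ℕ => m.real (⋃ i, A i) - ∑ i ∈ F, m.real (A i))
              atTop (𝓝 0) := by
            have h3 : Tendsto (fun F : Finset ℕ => ∑ i ∈ F, m.real (A i)) atTop
              (𝓝 (m.real (⋃ i, A i))) := hm
            simpa using h3.const_sub (m.real (⋃ i, A i))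
          have h2 := (h1.rpow_const (p := 1 / q.toReal) (Or.inr hqpos.le)).const_mul C
          rwa [Real.zero_rpow hqpos.ne', mul_zero] at h2 }
  have hS : ∀ s (hs : MeasurableSet s), S s = Φ (I ⟨s, hs⟩) := fun s hs => dif_pos hs
  have hac : VectorMeasure.AbsolutelyContinuous S m.toENNRealVectorMeasure := by
    refine VectorMeasure.AbsolutelyContinuous.mk fun s hs h0 => ?_
    rw [Measure.toENNRealVectorMeasure_apply_measurable hs] at h0
    have := hI ⟨s, hs⟩
    rw [measureReal_def, h0, ENNReal.toReal_zero, Real.zero_rpow hqpos.ne', mul_zero] at this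
    rw [hS s hs]
    exact abs_nonpos_iff.1 this
  set g := S.rnDeriv m
  have hg : Integrable g m := S.integrable_rnDeriv m
  have hdens := SignedMeasure.withDensityᵥ_rnDeriv_eq S m hac
  have hSg : ∀ s (hs : MeasurableSet s), Φ (I ⟨s, hs⟩) = ∫ x in s, g x ∂m := by
    intro s hs
    rw [← hS s hs, ← withDensityᵥ_apply hg hs, hdens]
  refine ⟨g, hg, fun f => ?_⟩
  have hsimple : ∀ φ : SimpleFunc α ℝ, ∀ hφ : (φ : α → ℝ) ∈ boundedMeasurable α,
      Φ ⟨φ, hφ⟩ = ∫ x, φ x * g x ∂m := by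
    intro φ
    induction φ using SimpleFunc.induction with
    | @const c s hs =>
      intro hφ
      have : (⟨_, hφ⟩ : boundedMeasurable α) = c • I ⟨s, hs⟩ := by
        ext x
        by_cases hx : x ∈ s <;> simp [I, hx]
      rw [this, map_smul, hSg s hs, smul_eq_mul, ← integral_const_mul, ← integral_indicator hs]
      refine integral_congr_ae (ae_of_all _ fun x => ?_)
      by_cases hx : x ∈ s <;> simp [hx]
    | @add φ₁ φ₂ _ h1 h2 =>
      intro hφ
      have hb : ∀ φ : SimpleFunc α ℝ, (φ : α → ℝ) ∈ boundedMeasurable α := fun φ =>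
        ⟨φ.measurable, by
          obtain ⟨C, hC⟩ := φ.exists_forall_norm_le
          exact ⟨C, hC⟩⟩
      have hint : ∀ φ : SimpleFunc α ℝ, Integrable (fun x => φ x * g x) m := fun φ => by
        obtain ⟨C, hC⟩ := φ.exists_forall_norm_le
        exact hg.bdd_mul φ.measurable.aestronglyMeasurable (ae_of_all _ hC)
      have : (⟨_, hφ⟩ : boundedMeasurable α) = ⟨φ₁, hb φ₁⟩ + ⟨φ₂, hb φ₂⟩ := by
        ext x; simp
      rw [this, map_add, h1, h2, ← integral_add (hint _) (hint _)]
      simp only [SimpleFunc.coe_add, Pi.add_apply, add_mul]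
  obtain ⟨f, hfm, D, hD⟩ := f
  have hfg : Integrable (fun x => f x * g x) m :=
    hg.bdd_mul hfm.aestronglyMeasurable (ae_of_all _ hD)
  -- Rounding f down to multiples of 1/(k+1) gives a simple function uniformly within 1/(k+1), and
  -- both sides are continuous for uniform convergence because m is finite and g is integrable.
  have key : ∀ k : ℕ, |Φ ⟨f, hfm, D, hD⟩ - ∫ x, f x * g x ∂m| ≤
      (|C| * (m.real Set.univ) ^ (1 / q.toReal) + ∫ x, |g x| ∂m) * (1 / ((k : ℝ) + 1)) := by
    intro k
    have hk : (0 : ℝ) < (k : ℝ) + 1 := by positivity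
    let φ : SimpleFunc α ℝ :=
      { toFun := fun x => (⌊((k : ℝ) + 1) * f x⌋ : ℝ) / (k + 1)
        measurableSet_fiber' := fun y => by
          have : Measurable fun x => (⌊((k : ℝ) + 1) * f x⌋ : ℝ) / (k + 1) :=
            ((measurable_from_top (f := fun z : ℤ => (z : ℝ))).comp
              (hfm.const_mul ((k : ℝ) + 1)).floor).div_const _
          exact this (measurableSet_singleton y)
        finite_range' := by
          refine ((Set.finite_Icc ⌊((k : ℝ) + 1) * (-D)⌋ ⌊((k : ℝ) + 1) * D⌋).image
            fun z : ℤ => (z : ℝ) / (k + 1)).subset ?_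
          rintro _ ⟨x, rfl⟩
          have := abs_le.1 (hD x)
          exact ⟨_, ⟨Int.floor_mono (mul_le_mul_of_nonneg_left this.1 hk.le),
            Int.floor_mono (mul_le_mul_of_nonneg_left this.2 hk.le)⟩, rfl⟩ }
    have hclose : ∀ x, |f x - φ x| ≤ 1 / ((k : ℝ) + 1) := by
      intro x
      change |f x - (⌊((k : ℝ) + 1) * f x⌋ : ℝ) / (k + 1)| ≤ _
      have h1 := Int.floor_le (((k : ℝ) + 1) * f x)
      have h2 := Int.lt_floor_add_one (((k : ℝ) + 1) * f x)
      have e : f x - (⌊((k : ℝ) + 1) * f x⌋ : ℝ) / (k + 1) =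
          ((k + 1) * f x - ⌊((k : ℝ) + 1) * f x⌋) / (k + 1) := by field_simp
      rw [e, abs_div, abs_of_pos hk]
      gcongr
      rw [abs_le]; constructor <;> linarith
    have hφ : (φ : α → ℝ) ∈ boundedMeasurable α := ⟨φ.measurable, by
      obtain ⟨C, hC⟩ := φ.exists_forall_norm_le
      exact ⟨C, hC⟩⟩
    have hφg : Integrable (fun x => φ x * g x) m := by
      obtain ⟨C, hC⟩ := φ.exists_forall_norm_le
      exact hg.bdd_mul φ.measurable.aestronglyMeasurable (ae_of_all _ hC)
    have e1 : Φ ⟨f, hfm, D, hD⟩ - ∫ x, f x * g x ∂m =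
        Φ (⟨f, hfm, D, hD⟩ - ⟨φ, hφ⟩) - ∫ x, (f x - φ x) * g x ∂m := by
      rw [map_sub, hsimple φ hφ]
      simp only [sub_mul]
      rw [integral_sub hfg hφg]; ring
    have b1 : |Φ (⟨f, hfm, D, hD⟩ - ⟨φ, hφ⟩)| ≤
        |C| * ((m.real Set.univ) ^ (1 / q.toReal) * (1 / ((k : ℝ) + 1))) := by
      refine (hΦ _).trans ?_
      have h1 : eLpNorm (fun x => f x - φ x) q m ≤
          m Set.univ ^ (1 / q.toReal) * ENNReal.ofReal (1 / ((k : ℝ) + 1)) := by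
        rw [one_div q.toReal]
        exact eLpNorm_le_of_ae_bound (μ := m) (p := q) (ae_of_all _ hclose)
      have h2 := ENNReal.toReal_mono (by finiteness) h1
      rw [ENNReal.toReal_mul, ← ENNReal.toReal_rpow, ENNReal.toReal_ofReal (by positivity)] at h2
      exact (mul_le_mul_of_nonneg_right (le_abs_self C) ENNReal.toReal_nonneg).trans
        (mul_le_mul_of_nonneg_left h2 (abs_nonneg C))
    have b2 : |∫ x, (f x - φ x) * g x ∂m| ≤ (∫ x, |g x| ∂m) * (1 / ((k : ℝ) + 1)) := by
      rw [← integral_mul_const, ← Real.norm_eq_abs]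
      refine norm_integral_le_of_norm_le (hg.abs.mul_const _) (ae_of_all _ fun x => ?_)
      rw [norm_mul, mul_comm]
      exact mul_le_mul_of_nonneg_left (hclose x) (abs_nonneg _)
    rw [e1]
    refine (abs_sub _ _).trans ((add_le_add b1 b2).trans (le_of_eq ?_))
    ring
  have hlim := tendsto_one_div_add_atTop_nhds_zero_nat.const_mul
    (|C| * (m.real Set.univ) ^ (1 / q.toReal) + ∫ x, |g x| ∂m)
  rw [mul_zero] at hlim
  exact sub_eq_zero.1 (abs_nonpos_iff.1 (ge_of_tendsto' hlim key))

/-- Hahn–Banach with the sublinear majorant C‖·‖_q on bounded measurable functions; q ≥ 1 gives the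
triangle inequality. Extending to that space makes indicators available to the representation
result. -/
lemma exists_density_of_bounded_on {α : Type*} [MeasurableSpace α] (m : Measure α)
    [IsFiniteMeasure m] {q : ℝ≥0∞} (hq1 : 1 ≤ q) (hq : q ≠ ⊤) {V : Submodule ℝ (α → ℝ)}
    (hV : V ≤ boundedMeasurable α) (T : V →ₗ[ℝ] ℝ) {C : ℝ} (hC : 0 ≤ C)
    (hT : ∀ ψ : V, |T ψ| ≤ C * (eLpNorm (ψ : α → ℝ) q m).toReal) :
    ∃ g : α → ℝ, Integrable g m ∧ ∀ ψ : V, T ψ = ∫ x, (ψ : α → ℝ) x * g x ∂m := by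
  let N : boundedMeasurable α → ℝ := fun f => C * (eLpNorm (f : α → ℝ) q m).toReal
  have hmem : ∀ f : boundedMeasurable α, MemLp (f : α → ℝ) q m := fun f =>
    memLp_of_mem_boundedMeasurable f.2 q
  let f : boundedMeasurable α →ₗ.[ℝ] ℝ :=
    ⟨V.comap (boundedMeasurable α).subtype,
      T.comp ((boundedMeasurable α).subtype.restrict (q := V) fun x hx => hx)⟩
  obtain ⟨Φ, hΦf, hΦN⟩ := exists_extension_of_le_sublinear f N
    (fun c hc x => by
      have : eLpNorm ((c • x : boundedMeasurable α) : α → ℝ) q m =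
          ENNReal.ofReal c * eLpNorm (x : α → ℝ) q m := by
        rw [Submodule.coe_smul, eLpNorm_const_smul, Real.enorm_of_nonneg hc.le]
      simp only [N, this, ENNReal.toReal_mul, ENNReal.toReal_ofReal hc.le]
      ring)
    (fun x y => by
      simp only [N, ← mul_add]
      refine mul_le_mul_of_nonneg_left ?_ hC
      rw [← ENNReal.toReal_add (hmem x).eLpNorm_ne_top (hmem y).eLpNorm_ne_top]
      refine ENNReal.toReal_mono (ENNReal.add_ne_top.2
        ⟨(hmem x).eLpNorm_ne_top, (hmem y).eLpNorm_ne_top⟩) ?_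
      rw [Submodule.coe_add]
      exact eLpNorm_add_le (hmem x).aestronglyMeasurable (hmem y).aestronglyMeasurable hq1)
    (fun x => (le_abs_self _).trans (hT _))
  have hΦ : ∀ f, |Φ f| ≤ C * (eLpNorm (f : α → ℝ) q m).toReal := by
    intro f
    refine abs_le.2 ⟨?_, hΦN f⟩
    have := hΦN (-f)
    simp only [N, map_neg, Submodule.coe_neg, eLpNorm_neg] at this
    linarith
  obtain ⟨g, hg, hgΦ⟩ := exists_density_of_bounded m (by positivity) hq Φ hΦ
  refine ⟨g, hg, fun ψ => ?_⟩
  rw [← hgΦ ⟨ψ, hV ψ.2⟩]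
  exact (hΦf ⟨⟨ψ, hV ψ.2⟩, ψ.2⟩).symm

/-! ### Existence of weak gradients from finite energy -/

/-- The second moment of a unit vector over the unit ball. -/
lemma exists_integral_inner_mul_clm {n : ℕ} {w : Euc n} (hw : ‖w‖ = 1) :
    ∃ κ : ℝ, 0 < κ ∧ ∀ ℓ : Euc n →L[ℝ] ℝ,
      ∫ v in ball (0 : Euc n) 1, inner ℝ w v * ℓ v = κ * ℓ w := by
  have hint : ∀ g : Euc n → ℝ, Continuous g → IntegrableOn g (ball (0 : Euc n) 1) := fun g hg =>
    (hg.continuousOn.integrableOn_compact (isCompact_closedBall (0 : Euc n) 1)).mono_set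
      ball_subset_closedBall
  refine ⟨∫ v in ball (0 : Euc n) 1, (inner ℝ w v : ℝ) ^ 2, ?_, fun ℓ => ?_⟩
  · rw [setIntegral_pos_iff_support_of_nonneg_ae (ae_of_all _ fun v => sq_nonneg _)
      (hint _ (by fun_prop))]
    have hopen : IsOpen ({v : Euc n | 0 < (inner ℝ w v : ℝ)} ∩ ball 0 1) :=
      (isOpen_lt continuous_const (by fun_prop)).inter isOpen_ball
    refine (hopen.measure_pos volume ⟨(1 / 2 : ℝ) • w, ?_, ?_⟩).trans_le
      (measure_mono (Set.inter_subset_inter_left _ fun v hv => ?_))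
    · simp [inner_smul_right, hw]
    · rw [mem_ball_zero_iff, norm_smul, hw]; norm_num
    · exact pow_ne_zero 2 (ne_of_gt hv)
  -- Split v into its component along w and the rest. The mixed term F is odd under the reflection
  -- in w^⊥, which preserves the ball, so it integrates to zero.
  · set R := (ℝ ∙ w)ᗮ.reflection
    have hRw : R w = -w := by
      apply Submodule.reflection_mem_subspace_orthogonal_precomplement_eq_neg
      exact Submodule.mem_span_singleton_self w
    have hin : ∀ v, (inner ℝ w (R v) : ℝ) = -inner ℝ w v := by
      intro v
      have : (inner ℝ (R w) (R v) : ℝ) = inner ℝ w v := R.inner_map_map w v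
      rw [hRw, inner_neg_left] at this
      linarith
    have hR : ∀ v, R v = v - (2 * inner ℝ w v : ℝ) • w := by
      intro v
      rw [Submodule.reflection_orthogonal_apply, Submodule.reflection_singleton_apply, hw]
      simp [two_smul, add_smul, two_mul]
    set F : Euc n → ℝ := fun v => inner ℝ w v * ℓ (v - (inner ℝ w v : ℝ) • w) with hF
    have hFc : Continuous F := by fun_prop
    have hodd : ∀ v, F (R v) = -F v := by
      intro v
      have : R v - (inner ℝ w (R v) : ℝ) • w = v - (inner ℝ w v : ℝ) • w := by
        rw [hin, hR, two_mul, add_smul, neg_smul]; abel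
      change (inner ℝ w (R v) : ℝ) * ℓ (R v - (inner ℝ w (R v) : ℝ) • w) = _
      rw [this, hin, neg_mul]
    have hzero : ∫ v in ball (0 : Euc n) 1, F v = 0 := by
      have hpre : R ⁻¹' ball (0 : Euc n) 1 = ball 0 1 := by ext; simp
      have h1 := (LinearIsometryEquiv.measurePreserving R).setIntegral_preimage_emb
        R.toMeasurableEquiv.measurableEmbedding F (ball (0 : Euc n) 1)
      rw [hpre] at h1
      simp only [hodd, integral_neg] at h1
      linarith
    have hsplit : ∀ v : Euc n, (inner ℝ w v : ℝ) * ℓ v = (inner ℝ w v : ℝ) ^ 2 * ℓ w + F v := by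
      intro v
      simp only [hF, map_sub, map_smul, smul_eq_mul]; ring
    simp only [hsplit]
    rw [integral_add (hint _ (by fun_prop)) (hint _ hFc), hzero, add_zero, integral_mul_const]

/-- Test functions on `Ω`. -/
def testFunctions {n : ℕ} (Ω : Set (Euc n)) : Submodule ℝ (Euc n → ℝ) where
  carrier := {ψ | ContDiff ℝ (⊤ : ℕ∞) ψ ∧ HasCompactSupport ψ ∧ tsupport ψ ⊆ Ω}
  add_mem' := by
    rintro f g ⟨h1, h2, h3⟩ ⟨h4, h5, h6⟩
    exact ⟨h1.add h4, h2.add h5, (tsupport_add f g).trans (Set.union_subset h3 h6)⟩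
  zero_mem' := ⟨contDiff_const, HasCompactSupport.zero, by simp [tsupport]⟩
  smul_mem' := by
    rintro c f ⟨h1, h2, h3⟩
    exact ⟨h1.const_smul c, h2.smul_left (f := fun _ => c), (closure_mono fun x hx => by
      simp only [Function.mem_support, Pi.smul_apply, smul_eq_mul] at hx ⊢
      exact right_ne_zero_of_mul hx).trans h3⟩

lemma testFunctions_le_boundedMeasurable {n : ℕ} (Ω : Set (Euc n)) :
    testFunctions Ω ≤ boundedMeasurable (Euc n) := by
  rintro ψ ⟨h1, h2, -⟩
  obtain ⟨C, hC⟩ := h1.continuous.bounded_above_of_compact_support h2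
  exact ⟨h1.continuous.measurable, C, hC⟩

lemma isNonnegCc_abs {n : ℕ} {Ω : Set (Euc n)} {ψ : Euc n → ℝ} (hψ : ψ ∈ testFunctions Ω) :
    IsNonnegCc Ω (fun x => |ψ x|) := by
  obtain ⟨h1, h2, h3⟩ := hψ
  have : tsupport (fun x => |ψ x|) = tsupport ψ := by
    refine congrArg closure (Set.ext fun x => ?_)
    simp
  exact ⟨h1.continuous.abs, by rw [HasCompactSupport, this]; exact h2, by rw [this]; exact h3,
    fun x => abs_nonneg _⟩

/-- The distributional derivative is controlled by the averaged difference quotients. -/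
lemma enorm_integral_mul_fderiv_le_liminf {n : ℕ} (hn : 0 < n) {X : Type*} [MetricSpace X]
    {Ω : Set (Euc n)} (hΩ : IsOpen Ω) (hΩb : Bornology.IsBounded Ω) {u : Euc n → X}
    (hu : StronglyMeasurable u) (ξ : X)
    (hfi : IntegrableOn (fun x => dist (u x) ξ) Ω) {w : Euc n} (hw : ‖w‖ = 1) :
    ∃ κ : ℝ, 0 < κ ∧ ∀ ψ ∈ testFunctions Ω,
      ENNReal.ofReal κ * ‖∫ x in Ω, dist (u x) ξ * fderiv ℝ ψ x w‖ₑ ≤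
        liminf (fun h => ∫⁻ v in ball (0 : Euc n) 1, quotEnergy 1 u (fun x => |ψ x|) h v)
          (𝓝[>] 0) := by
  obtain ⟨κ, hκ, hκℓ⟩ := exists_integral_inner_mul_clm hw
  refine ⟨κ, hκ, ?_⟩
  rintro ψ ⟨hψ, hψc, hψΩ⟩
  set f : Euc n → ℝ := fun x => dist (u x) ξ with hf
  have hfm : StronglyMeasurable f := hu.dist stronglyMeasurable_const
  set F : Euc n → ℝ := Ω.indicator f with hF
  have hFm : StronglyMeasurable F := hfm.indicator hΩ.measurableSet
  have hFi : Integrable F := (integrable_indicator_iff hΩ.measurableSet).2 hfi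
  set B := ball (0 : Euc n) 1
  have hfinB : IsFiniteMeasure (volume.restrict B : Measure (Euc n)) :=
    ⟨by simpa using measure_ball_lt_top⟩
  obtain ⟨C, hC⟩ := hψ.lipschitzWith_of_hasCompactSupport hψc (by simp)
  obtain ⟨D, hD⟩ := hψ.continuous.bounded_above_of_compact_support hψc
  have hin : ∀ v ∈ B, |(inner ℝ w v : ℝ)| ≤ 1 := fun v hv =>
    (abs_real_inner_le_norm w v).trans (by rw [hw, one_mul]; exact (mem_ball_zero_iff.1 hv).le)
  set P := (volume.restrict B : Measure (Euc n)).prod (volume : Measure (Euc n))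
  have hPB : ∀ᵐ z ∂P, z.1 ∈ B :=
    Measure.quasiMeasurePreserving_fst.ae (ae_restrict_mem measurableSet_ball)
  -- C is a Lipschitz constant of ψ; it bounds the difference quotients and the derivative of ψ in
  -- every direction of the unit ball, so this function dominates uniformly in h.
  have hdom : Integrable (fun z : Euc n × Euc n => C * ‖F z.2‖) P := hFi.norm.comp_snd _ |>.const_mul _
  have hinc : Continuous fun z : Euc n × Euc n => (inner ℝ w z.1 : ℝ) := by fun_prop
  have hψcont := hψ.continuous
  have hFsnd : AEStronglyMeasurable (fun z : Euc n × Euc n => F z.2) P :=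
    (hFm.comp_measurable measurable_snd).aestronglyMeasurable
  have hmeas : ∀ {k : Euc n × Euc n → ℝ}, Continuous k →
      AEStronglyMeasurable (fun z : Euc n × Euc n => (inner ℝ w z.1 : ℝ) * (F z.2 * k z)) P :=
    fun hk => hinc.aestronglyMeasurable.mul (hFsnd.mul hk.aestronglyMeasurable)
  have hdomle : ∀ {k : Euc n × Euc n → ℝ}, (∀ z, z.1 ∈ B → ‖k z‖ ≤ C) →
      ∀ᵐ z ∂P, ‖(inner ℝ w z.1 : ℝ) * (F z.2 * k z)‖ ≤ C * ‖F z.2‖ := by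
    intro k hk
    filter_upwards [hPB] with z hz
    rw [norm_mul, norm_mul, mul_comm (C : ℝ)]
    refine (mul_le_of_le_one_left (by positivity) (hin _ hz)).trans ?_
    exact mul_le_mul_of_nonneg_left (hk z hz) (norm_nonneg _)
  have hquot : ∀ h : ℝ, 0 < h → ∀ z : Euc n × Euc n, z.1 ∈ B →
      ‖h⁻¹ * (ψ (z.2 - h • z.1) - ψ z.2)‖ ≤ C := by
    intro h hh z hz
    have h1 := hC.norm_sub_le (z.2 - h • z.1) z.2
    rw [sub_sub_cancel_left, norm_neg, norm_smul, Real.norm_of_nonneg hh.le] at h1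
    rw [norm_mul, norm_inv, Real.norm_of_nonneg hh.le, inv_mul_le_iff₀ hh]
    refine h1.trans ?_
    rw [mul_comm h (C : ℝ)]
    refine mul_le_mul_of_nonneg_left ?_ C.2
    exact mul_le_of_le_one_right hh.le (mem_ball_zero_iff.1 hz).le
  have hderb : ∀ z : Euc n × Euc n, z.1 ∈ B → ‖-fderiv ℝ ψ z.2 z.1‖ ≤ C := by
    intro z hz
    rw [norm_neg]
    refine ((fderiv ℝ ψ z.2).le_opNorm _).trans ?_
    have := norm_fderiv_le_of_lipschitz ℝ hC (x₀ := z.2)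
    exact (mul_le_of_le_one_right (norm_nonneg _) (mem_ball_zero_iff.1 hz).le).trans this
  have hderc : Continuous fun z : Euc n × Euc n => -fderiv ℝ ψ z.2 z.1 := by
    have := hψ.continuous_fderiv (by simp)
    fun_prop
  -- limit of the symmetrized quotients
  have hlim : Tendsto (fun h : ℝ => ∫ z, (inner ℝ w z.1 : ℝ) *
      (F z.2 * (h⁻¹ * (ψ (z.2 - h • z.1) - ψ z.2))) ∂P) (𝓝[>] 0)
      (𝓝 (∫ z, (inner ℝ w z.1 : ℝ) * (F z.2 * (-fderiv ℝ ψ z.2 z.1)) ∂P)) := by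
    refine tendsto_integral_filter_of_dominated_convergence _
      (Eventually.of_forall fun h => hmeas (by fun_prop)) ?_ hdom (ae_of_all _ fun z => ?_)
    · filter_upwards [self_mem_nhdsWithin] with h hh
      exact hdomle (hquot h hh)
    · refine Tendsto.const_mul _ (Tendsto.const_mul _ ?_)
      have h1 : HasDerivAt (fun t : ℝ => z.2 - t • z.1) (-z.1) 0 := by
        simpa using ((hasDerivAt_id (0 : ℝ)).smul_const z.1).const_sub z.2
      have h2 := (hψ.differentiable (by simp) (z.2 - (0 : ℝ) • z.1)).hasFDerivAt.comp_hasDerivAt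
        (0 : ℝ) h1
      have h3 := h2.tendsto_slope_zero_right
      simpa using h3
  -- Integrating in v first, the second-moment identity isolates the derivative in direction w.
  have hval : ∫ z, (inner ℝ w z.1 : ℝ) * (F z.2 * (-fderiv ℝ ψ z.2 z.1)) ∂P =
      -(κ * ∫ x in Ω, f x * fderiv ℝ ψ x w) := by
    have hi : Integrable (fun z : Euc n × Euc n => (inner ℝ w z.1 : ℝ) *
        (F z.2 * (-fderiv ℝ ψ z.2 z.1))) P := hdom.mono' (hmeas hderc) (hdomle hderb)
    rw [integral_prod_symm _ hi, ← integral_const_mul, ← integral_neg,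
      ← integral_indicator hΩ.measurableSet]
    refine integral_congr_ae (ae_of_all _ fun y => ?_)
    have e1 : ∀ v, (inner ℝ w v : ℝ) * (F y * (-fderiv ℝ ψ y v)) =
        -F y * ((inner ℝ w v : ℝ) * fderiv ℝ ψ y v) := fun v => by ring
    simp only [e1, integral_const_mul]
    rw [hκℓ]
    by_cases hy : y ∈ Ω
    · simp only [hF, Set.indicator_of_mem hy]; ring
    · simp only [hF, Set.indicator_of_notMem hy]; ring
  obtain ⟨δ, hδ, hsub⟩ := exists_subset_innerSet hn hΩ hΩb hψc hψΩ
  -- A translation moves the difference quotient from ψ back to d(u, ξ), which is 1-Lipschitz in u.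
  -- For small h both x and x + hv lie in Ω when x is in the support of ψ, so the extension by zero
  -- does no harm.
  have hbound : ∀ᶠ h in 𝓝[>] (0 : ℝ), ‖∫ z, (inner ℝ w z.1 : ℝ) *
      (F z.2 * (h⁻¹ * (ψ (z.2 - h • z.1) - ψ z.2))) ∂P‖ₑ ≤
      ∫⁻ v in B, quotEnergy 1 u (fun x => |ψ x|) h v := by
    filter_upwards [Ioo_mem_nhdsGT hδ] with h hh
    have hh0 : 0 < h := hh.1
    have hi : Integrable (fun z : Euc n × Euc n => (inner ℝ w z.1 : ℝ) *
        (F z.2 * (h⁻¹ * (ψ (z.2 - h • z.1) - ψ z.2)))) P :=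
      hdom.mono' (hmeas (by fun_prop)) (hdomle (hquot h hh0))
    rw [integral_prod _ hi]
    refine (enorm_integral_le_lintegral_enorm _).trans
      (setLIntegral_mono' measurableSet_ball fun v hv => ?_)
    have hmul : ∀ {g : Euc n → ℝ}, Integrable g → ∀ {φ : Euc n → ℝ}, Continuous φ →
        (∀ x, ‖φ x‖ ≤ D) → Integrable (fun x => φ x * g x) := fun hg φ hφ hb =>
      hg.bdd_mul hφ.aestronglyMeasurable (ae_of_all _ hb)
    have a1 := hmul (hFi.comp_add_right (h • v)) hψ.continuous hD
    have a2 := hmul hFi hψ.continuous hD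
    have a3 := hmul hFi (φ := fun y => ψ (y - h • v)) (by fun_prop) fun x => hD _
    have e1 : ∫ y, F y * (h⁻¹ * (ψ (y - h • v) - ψ y)) =
        ∫ x, ψ x * (h⁻¹ * (F (x + h • v) - F x)) := by
      have b1 : ∫ x, ψ x * F (x + h • v) = ∫ y, ψ (y - h • v) * F y := by
        rw [← integral_add_right_eq_self (fun y => ψ (y - h • v) * F y) (h • v)]
        simp
      have b2 : ∫ x, ψ x * (h⁻¹ * (F (x + h • v) - F x)) =
          h⁻¹ * ((∫ x, ψ x * F (x + h • v)) - ∫ x, ψ x * F x) := by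
        rw [← integral_sub a1 a2, ← integral_const_mul]
        congr 1; ext x; ring
      have b3 : ∫ y, F y * (h⁻¹ * (ψ (y - h • v) - ψ y)) =
          h⁻¹ * ((∫ y, ψ (y - h • v) * F y) - ∫ x, ψ x * F x) := by
        rw [← integral_sub a3 a2, ← integral_const_mul]
        congr 1; ext x; ring
      rw [b2, b3, b1]
    simp only
    rw [integral_const_mul, e1, enorm_mul]
    have hle1 : ‖(inner ℝ w v : ℝ)‖ₑ ≤ 1 := by
      rw [← ofReal_norm]; exact ENNReal.ofReal_le_one.2 (hin v hv)
    refine (mul_le_mul' hle1 (enorm_integral_le_lintegral_enorm _)).trans ?_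
    rw [one_mul]
    refine lintegral_mono fun x => ?_
    rw [enorm_mul, Real.enorm_eq_ofReal_abs (ψ x)]
    by_cases hx : x ∈ tsupport ψ
    · refine mul_le_mul' le_rfl ?_
      have hx1 : x ∈ innerSet Ω h := hsub h hh.2 hx
      have hx2 : x + h • v ∈ Ω := add_mem_of_mem_innerSet hΩ hx1 (by
        rw [norm_smul, Real.norm_of_nonneg hh0.le]
        exact mul_le_of_le_one_right hh0.le (mem_ball_zero_iff.1 hv).le)
      rw [hF, Set.indicator_of_mem hx2, Set.indicator_of_mem hx1.1, enorm_mul,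
        Real.enorm_of_nonneg (inv_nonneg.2 hh0.le), ENNReal.ofReal_inv_of_pos hh0,
        ENNReal.rpow_one, ENNReal.div_eq_inv_mul, edist_comm]
      exact mul_le_mul' le_rfl (enorm_dist_sub_dist_le _ _ _)
    · simp [image_eq_zero_of_notMem_tsupport hx]
  have e : ENNReal.ofReal κ * ‖∫ x in Ω, f x * fderiv ℝ ψ x w‖ₑ =
      ‖-(κ * ∫ x in Ω, f x * fderiv ℝ ψ x w)‖ₑ := by
    rw [enorm_neg, enorm_mul, Real.enorm_of_nonneg hκ.le]
  rw [e, ← hval, ← hlim.enorm.liminf_eq]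
  exact liminf_le_liminf hbound

lemma exists_cutoff {n : ℕ} {Ω K : Set (Euc n)} (hΩ : IsOpen Ω) (hK : IsCompact K) (hKΩ : K ⊆ Ω) :
    ∃ η : Euc n → ℝ, (IsNonnegCc Ω η ∧ ∀ x, η x ≤ 1) ∧ ∀ x ∈ K, η x = 1 := by
  obtain ⟨L, hL, hKL, hLΩ⟩ := exists_compact_between hK hΩ hKΩ
  obtain ⟨f, hf1, hf0, hfc, hf⟩ := exists_continuous_one_zero_of_isCompact hK
    (isOpen_interior (s := L)).isClosed_compl (Set.disjoint_compl_right_iff_subset.2 hKL)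
  refine ⟨f, ⟨⟨f.continuous, hfc, ?_, fun x => (hf x).1⟩, fun x => (hf x).2⟩, fun x hx => hf1 hx⟩
  have : Function.support f ⊆ L := fun x hx => by
    by_contra hxL
    exact hx (hf0 fun h => hxL (interior_subset h))
  exact (closure_minimal this hL.isClosed).trans hLΩ

/-- Exhaust Ω by compact sets and take cutoffs equal to 1 on them. The cutoffs need not be monotone,
so Fatou replaces monotone convergence. -/
lemma setLIntegral_le_iSup_cutoff {n : ℕ} {Ω : Set (Euc n)} (hΩ : IsOpen Ω)
    (m : Measure (Euc n)) {Γ : Euc n → ℝ≥0∞} (hΓ : AEMeasurable Γ m) :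
    ∫⁻ x in Ω, Γ x ∂m ≤ ⨆ (η : Euc n → ℝ) (_ : IsNonnegCc Ω η ∧ ∀ x, η x ≤ 1),
      ∫⁻ x, ENNReal.ofReal (η x) * Γ x ∂m := by
  obtain ⟨F, hFc, hFΩ, hFU, hFm⟩ := hΩ.exists_iUnion_isClosed
  have hK : ∀ k : ℕ, IsCompact (F k ∩ closedBall 0 k) := fun k =>
    (isCompact_closedBall (0 : Euc n) k).inter_left (hFc k)
  choose η hη hη1 using fun k =>
    exists_cutoff hΩ (hK k) (Set.inter_subset_left.trans (hFΩ k))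
  have hlim : ∀ x ∈ Ω, Tendsto (fun k => ENNReal.ofReal (η k x) * Γ x) atTop (𝓝 (Γ x)) := by
    intro x hx
    rw [← hFU] at hx
    obtain ⟨i, hi⟩ := Set.mem_iUnion.1 hx
    obtain ⟨j, hj⟩ := exists_nat_ge ‖x‖
    refine tendsto_const_nhds.congr' ?_
    filter_upwards [eventually_ge_atTop (max i j)] with k hk
    rw [hη1 k x ⟨hFm ((le_max_left _ _).trans hk) hi, ?_⟩]
    · simp
    · rw [mem_closedBall_zero_iff]
      exact hj.trans (by exact_mod_cast (le_max_right _ _).trans hk)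
  calc ∫⁻ x in Ω, Γ x ∂m
      ≤ ∫⁻ x in Ω, liminf (fun k => ENNReal.ofReal (η k x) * Γ x) atTop ∂m :=
        setLIntegral_mono' hΩ.measurableSet fun x hx => (hlim x hx).liminf_eq.ge
    _ ≤ liminf (fun k => ∫⁻ x in Ω, ENNReal.ofReal (η k x) * Γ x ∂m) atTop :=
        lintegral_liminf_le' fun k =>
          ((hη k).1.continuous.measurable.ennreal_ofReal.aemeasurable.mul hΓ).restrict
    _ ≤ _ := by
        refine liminf_le_of_frequently_le' (Frequently.of_forall fun k => ?_)
        exact (setLIntegral_le_lintegral _ _).trans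
          (le_iSup₂ (f := fun (η : Euc n → ℝ) (_ : IsNonnegCc Ω η ∧ ∀ x, η x ≤ 1) =>
            ∫⁻ x, ENNReal.ofReal (η x) * Γ x ∂m) (η k) (hη k))

lemma ksConst_ne_zero {n : ℕ} (hn : 0 < n) {p : ℝ} (hp : 0 ≤ p) : ksConst n p ≠ 0 := by
  have hn0 : (0 : ℝ) < n := by exact_mod_cast hn
  have hb : 0 < volume.real (ball (0 : Euc n) 1) :=
    ENNReal.toReal_pos (isOpen_ball.measure_ne_zero _ ⟨0, by simp⟩) measure_ball_lt_top.ne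
  rw [ksConst, ne_eq, ENNReal.ofReal_eq_zero, not_le]
  positivity

lemma integrableOn_mul_of_testFunction {n : ℕ} {Ω : Set (Euc n)} {f ψ : Euc n → ℝ}
    (hf : IntegrableOn f Ω) (hψ : Continuous ψ) (hc : HasCompactSupport ψ) :
    IntegrableOn (fun x => f x * ψ x) Ω := by
  obtain ⟨C, hC⟩ := hψ.bounded_above_of_compact_support hc
  exact Integrable.mul_bdd hf hψ.aestronglyMeasurable (ae_of_all _ hC)

/-- An `L^q` bound for the distributional derivative yields an integrable weak derivative. -/
lemma exists_weak_partial {n : ℕ} {Ω : Set (Euc n)} {f : Euc n → ℝ}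
    (hf : IntegrableOn f Ω) (w : Euc n) (m : Measure (Euc n)) [IsFiniteMeasure m]
    (hm : m ≪ volume) {q : ℝ≥0∞} (hq1 : 1 ≤ q) (hq : q ≠ ⊤) {C : ℝ} (hC : 0 ≤ C)
    (hT : ∀ ψ ∈ testFunctions Ω,
      |∫ x in Ω, f x * fderiv ℝ ψ x w| ≤ C * (eLpNorm ψ q m).toReal) :
    ∃ g : Euc n → ℝ, Integrable g ∧ ∀ ψ ∈ testFunctions Ω,
      ∫ x in Ω, f x * fderiv ℝ ψ x w = ∫ x in Ω, g x * ψ x := by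
  have hcd : ∀ {ψ : Euc n → ℝ}, ψ ∈ testFunctions Ω →
      IntegrableOn (fun x => f x * fderiv ℝ ψ x w) Ω := fun hψ =>
    integrableOn_mul_of_testFunction hf
      (by have := hψ.1.continuous_fderiv (by simp); fun_prop) (hψ.2.1.fderiv_apply (𝕜 := ℝ) w)
  let T : testFunctions Ω →ₗ[ℝ] ℝ :=
    { toFun := fun ψ => ∫ x in Ω, f x * fderiv ℝ (ψ : Euc n → ℝ) x w
      map_add' := fun ψ φ => by
        rw [← integral_add (hcd ψ.2) (hcd φ.2)]
        refine integral_congr_ae (ae_of_all _ fun x => ?_)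
        simp only [Submodule.coe_add]
        rw [fderiv_add (ψ.2.1.differentiable (by simp) x) (φ.2.1.differentiable (by simp) x)]
        simp [mul_add]
      map_smul' := fun c ψ => by
        rw [RingHom.id_apply, smul_eq_mul, ← integral_const_mul]
        refine integral_congr_ae (ae_of_all _ fun x => ?_)
        simp only [Submodule.coe_smul]
        rw [fderiv_const_smul (ψ.2.1.differentiable (by simp) x)]
        simp; ring }
  obtain ⟨g, hg, hgT⟩ := exists_density_of_bounded_on m hq1 hq
    (testFunctions_le_boundedMeasurable Ω) T hC (fun ψ => hT ψ ψ.2)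
  -- The density found is relative to m; m ≪ volume converts it into a Lebesgue density. For p = 1
  -- this is where absolute continuity of the energy measure enters.
  refine ⟨fun x => (m.rnDeriv volume x).toReal • g x, (integrable_rnDeriv_smul_iff hm).2 hg,
    fun ψ hψ => ?_⟩
  have h1 : ∫ x in Ω, (m.rnDeriv volume x).toReal • g x * ψ x =
      ∫ x, (m.rnDeriv volume x).toReal • (g x * ψ x) := by
    simp only [smul_mul_assoc]
    refine setIntegral_eq_integral_of_forall_compl_eq_zero fun x hx => ?_
    rw [image_eq_zero_of_notMem_tsupport fun h => hx (hψ.2.2 h)]; simp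
  rw [h1, integral_rnDeriv_smul hm]
  have := hgT ⟨ψ, hψ⟩
  simp only [mul_comm (g _)]
  exact this

lemma isWeakGradient_of_weak_partials {n : ℕ} {Ω : Set (Euc n)} {f : Euc n → ℝ}
    (hf : IntegrableOn f Ω) {g : Fin n → Euc n → ℝ} (hg : ∀ i, Integrable (g i))
    (h : ∀ i, ∀ ψ ∈ testFunctions Ω,
      ∫ x in Ω, f x * fderiv ℝ ψ x (EuclideanSpace.single i 1) = ∫ x in Ω, g i x * ψ x) :
    IsWeakGradient Ω f (fun x => -∑ i, g i x • (EuclideanSpace.single i 1 : Euc n)) ∧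
      Integrable (fun x => -∑ i, g i x • (EuclideanSpace.single i 1 : Euc n)) := by
  have hG : Integrable (fun x => -∑ i, g i x • (EuclideanSpace.single i 1 : Euc n)) :=
    (integrable_finsetSum _ fun i _ => (hg i).smul_const _).neg
  refine ⟨⟨hf.locallyIntegrableOn, hG.integrableOn.locallyIntegrableOn,
    fun ψ hψ hc hs w => ?_⟩, hG⟩
  have hψ' : ψ ∈ testFunctions Ω := ⟨hψ, hc, hs⟩
  have hw : w = ∑ i, w i • (EuclideanSpace.single i 1 : Euc n) := by
    ext j; simp [Pi.single_apply]
  have e1 : ∀ x, f x * fderiv ℝ ψ x w =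
      ∑ i, w i * (f x * fderiv ℝ ψ x (EuclideanSpace.single i 1)) := by
    intro x
    conv_lhs => rw [hw]
    simp only [map_sum, map_smul, smul_eq_mul, Finset.mul_sum]
    exact Finset.sum_congr rfl fun i _ => by ring
  have e2 : ∀ x, (inner ℝ w (-∑ i, g i x • (EuclideanSpace.single i 1 : Euc n)) : ℝ) * ψ x =
      -∑ i, w i * (g i x * ψ x) := by
    intro x
    rw [inner_neg_right, inner_sum, neg_mul, Finset.sum_mul]
    congr 1
    refine Finset.sum_congr rfl fun i _ => ?_
    rw [inner_smul_right, EuclideanSpace.inner_single_right]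
    simp; ring
  simp only [e1, e2, integral_neg, neg_neg]
  rw [integral_finsetSum, integral_finsetSum]
  · refine Finset.sum_congr rfl fun i _ => ?_
    rw [integral_const_mul, integral_const_mul, h i ψ hψ']
  · exact fun i _ => (integrableOn_mul_of_testFunction (hg i).integrableOn hψ.continuous
      hc).const_mul _
  · exact fun i _ => (integrableOn_mul_of_testFunction hf
      (by have := hψ.continuous_fderiv (by simp); fun_prop) (hc.fderiv_apply (𝕜 := ℝ) _)).const_mul _

lemma MemLpMap.memLp_dist {n : ℕ} {X : Type*} [MetricSpace X] {Ω : Set (Euc n)} {p : ℝ}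
    {u : Euc n → X} (hu : MemLpMap Ω p u) (hΩb : Bornology.IsBounded Ω) (ξ : X) :
    MemLp (fun x => dist (u x) ξ) (ENNReal.ofReal p) (volume.restrict Ω) := by
  obtain ⟨hm, ξ₀, h0⟩ := hu
  have : IsFiniteMeasure (volume.restrict Ω) := ⟨by simpa using hΩb.measure_lt_top⟩
  refine (h0.add (memLp_const (dist ξ₀ ξ))).mono (hm.dist aestronglyMeasurable_const)
    (ae_of_all _ fun x => ?_)
  rw [Real.norm_of_nonneg dist_nonneg]
  exact (dist_triangle _ ξ₀ _).trans (le_abs_self _)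

/-- Common form of the cases p = 1 and p > 1: any bound of the averaged quotients by an L^q(m) norm
of ψ yields the partial derivatives one coordinate at a time. -/
lemma exists_isWeakGradient_of_liminf_le {n : ℕ} (hn : 0 < n) {X : Type*} [MetricSpace X]
    {Ω : Set (Euc n)} (hΩ : IsOpen Ω) (hΩb : Bornology.IsBounded Ω) {u : Euc n → X}
    (hu : StronglyMeasurable u) (ξ : X) (hfi : IntegrableOn (fun x => dist (u x) ξ) Ω)
    (m : Measure (Euc n)) [IsFiniteMeasure m] (hm : m ≪ volume) {q : ℝ≥0∞} (hq1 : 1 ≤ q)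
    (hq : q ≠ ⊤) {K : ℝ≥0∞} (hK : K ≠ ⊤)
    (hb : ∀ ψ ∈ testFunctions Ω,
      liminf (fun h => ∫⁻ v in ball (0 : Euc n) 1, quotEnergy 1 u (fun x => |ψ x|) h v) (𝓝[>] 0) ≤
        K * eLpNorm ψ q m) :
    ∃ g : Euc n → Euc n, IsWeakGradient Ω (fun x => dist (u x) ξ) g ∧ Integrable g := by
  have hpart : ∀ i : Fin n, ∃ g : Euc n → ℝ, Integrable g ∧ ∀ ψ ∈ testFunctions Ω,
      ∫ x in Ω, dist (u x) ξ * fderiv ℝ ψ x (EuclideanSpace.single i 1) =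
        ∫ x in Ω, g x * ψ x := by
    intro i
    obtain ⟨κ, hκ, hκb⟩ := enorm_integral_mul_fderiv_le_liminf hn hΩ hΩb hu ξ hfi
      (w := EuclideanSpace.single i 1) (by simp)
    refine exists_weak_partial hfi _ m hm hq1 hq (C := κ⁻¹ * K.toReal) (by positivity)
      fun ψ hψ => ?_
    have h1 := (hκb ψ hψ).trans (hb ψ hψ)
    have hfin : eLpNorm ψ q m ≠ ⊤ := by
      obtain ⟨hψm, C, hC⟩ := testFunctions_le_boundedMeasurable Ω hψ
      exact (MemLp.of_bound hψm.aestronglyMeasurable C (ae_of_all _ hC)).eLpNorm_ne_top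
    have h2 := ENNReal.toReal_mono (ENNReal.mul_ne_top hK hfin) h1
    rw [ENNReal.toReal_mul, ENNReal.toReal_mul, ENNReal.toReal_ofReal hκ.le, toReal_enorm,
      Real.norm_eq_abs] at h2
    rw [mul_assoc, ← div_eq_inv_mul, le_div_iff₀ hκ, mul_comm]
    exact h2
  choose g hg hgψ using hpart
  exact ⟨_, isWeakGradient_of_weak_partials hfi hg hgψ⟩

lemma liminf_quotEnergy_one_le_of_isEnergyMeasure {n : ℕ} (hn : 0 < n) {X : Type*} [MetricSpace X]
    {Ω : Set (Euc n)} (hΩ : IsOpen Ω) (hΩb : Bornology.IsBounded Ω) {u : Euc n → X}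
    (hu : StronglyMeasurable u) {μ : Measure (Euc n)} (hμ : IsEnergyMeasure Ω 1 u μ)
    {ψ : Euc n → ℝ} (hψ : ψ ∈ testFunctions Ω) :
    liminf (fun h => ∫⁻ v in ball (0 : Euc n) 1, quotEnergy 1 u (fun x => |ψ x|) h v) (𝓝[>] 0) ≤
      (ksConst n 1)⁻¹ * eLpNorm ψ 1 μ := by
  have h1 := (hμ.tendsto _ (isNonnegCc_abs hψ)).congr'
    (eventually_lintegral_approxEnergy_eq hn hΩ hΩb zero_le_one hu (isNonnegCc_abs hψ))
  have hK0 := ksConst_ne_zero hn (zero_le_one' ℝ)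
  have h2 := ENNReal.Tendsto.const_mul h1 (Or.inr (ENNReal.inv_ne_top.2 hK0))
  simp only [← mul_assoc, ENNReal.inv_mul_cancel hK0 (ksConst_ne_top n 1), one_mul] at h2
  rw [h2.liminf_eq, eLpNorm_one_eq_lintegral_enorm]
  simp only [← Real.norm_eq_abs, ofReal_norm, le_refl]

/-- Hölder on B × ℝⁿ. The weight η, equal to 1 on the support of ψ, is inserted at no cost and keeps
the p-energy factor localized in Ω. -/
lemma lintegral_quotEnergy_one_le {n : ℕ} {X : Type*} [MetricSpace X] {Ω : Set (Euc n)} {p q : ℝ}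
    (hpq : p.HolderConjugate q) {u : Euc n → X} (hu : StronglyMeasurable u) {ψ η : Euc n → ℝ}
    (hψ : ψ ∈ testFunctions Ω) (hη : Measurable η) (hη1 : ∀ x ∈ tsupport ψ, η x = 1) (h : ℝ) :
    ∫⁻ v in ball (0 : Euc n) 1, quotEnergy 1 u (fun x => |ψ x|) h v ≤
      (∫⁻ v in ball (0 : Euc n) 1, quotEnergy p u η h v) ^ (1 / p) *
        (volume (ball (0 : Euc n) 1) ^ (1 / q) *
          eLpNorm ψ (ENNReal.ofReal q) (volume.restrict Ω)) := by
  have hp0 := hpq.pos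
  have hq0 := hpq.symm.pos
  have hψm : Measurable ψ := hψ.1.continuous.measurable
  set Q : Euc n × Euc n → ℝ≥0∞ := fun z =>
    edist (u z.2) (u (z.2 + h • z.1)) / ENNReal.ofReal h with hQ
  have hQm : Measurable Q :=
    ((measurable_edist_translate hu h).comp measurable_swap).div_const _
  have hηm : Measurable (fun z : Euc n × Euc n => ENNReal.ofReal (η z.2)) :=
    (hη.comp measurable_snd).ennreal_ofReal
  have hF : Measurable (fun z : Euc n × Euc n => ‖ψ z.2‖ₑ) := (hψm.comp measurable_snd).enorm
  have hA : Measurable (fun z => ENNReal.ofReal (η z.2) ^ (1 / p) * Q z) :=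
    (hηm.pow_const _).mul hQm
  have e1 : ∫⁻ v in ball (0 : Euc n) 1, quotEnergy 1 u (fun x => |ψ x|) h v =
      ∫⁻ z, (ENNReal.ofReal (η z.2) ^ (1 / p) * Q z) * ‖ψ z.2‖ₑ
        ∂((volume.restrict (ball (0 : Euc n) 1)).prod volume) := by
    rw [lintegral_prod (fun z : Euc n × Euc n =>
      (ENNReal.ofReal (η z.2) ^ (1 / p) * Q z) * ‖ψ z.2‖ₑ) (hA.mul hF).aemeasurable]
    refine lintegral_congr fun v => lintegral_congr fun x => ?_
    simp only [hQ, ENNReal.rpow_one, ← Real.norm_eq_abs, ofReal_norm]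
    by_cases hx : x ∈ tsupport ψ
    · rw [hη1 x hx]; simp [mul_comm]
    · simp [image_eq_zero_of_notMem_tsupport hx]
  have e2 : ∫⁻ z, (ENNReal.ofReal (η z.2) ^ (1 / p) * Q z) ^ p
        ∂((volume.restrict (ball (0 : Euc n) 1)).prod volume) =
      ∫⁻ v in ball (0 : Euc n) 1, quotEnergy p u η h v := by
    rw [lintegral_prod _ (hA.pow_const p).aemeasurable]
    refine lintegral_congr fun v => lintegral_congr fun x => ?_
    rw [ENNReal.mul_rpow_of_nonneg _ _ hp0.le, ← ENNReal.rpow_mul, one_div_mul_cancel hp0.ne',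
      ENNReal.rpow_one]
  have e3 : (∫⁻ z, ‖ψ z.2‖ₑ ^ q
        ∂((volume.restrict (ball (0 : Euc n) 1)).prod volume)) ^ (1 / q) =
      volume (ball (0 : Euc n) 1) ^ (1 / q) *
        eLpNorm ψ (ENNReal.ofReal q) (volume.restrict Ω) := by
    rw [lintegral_prod _ (hF.pow_const q).aemeasurable]
    dsimp only
    rw [lintegral_const, Measure.restrict_apply_univ,
      eLpNorm_restrict_eq_of_support_subset (subset_closure.trans hψ.2.2),
      eLpNorm_eq_lintegral_rpow_enorm_toReal (by simpa using hq0) ENNReal.ofReal_ne_top,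
      ENNReal.toReal_ofReal hq0.le, mul_comm, ENNReal.mul_rpow_of_nonneg _ _ (by positivity)]
  rw [e1, ← e2, ← e3]
  exact ENNReal.lintegral_mul_le_Lp_mul_Lq _ hpq hA.aemeasurable hF.aemeasurable

lemma liminf_quotEnergy_one_le_of_ksEnergy_lt_top {n : ℕ} (hn : 0 < n) {X : Type*} [MetricSpace X]
    {Ω : Set (Euc n)} (hΩ : IsOpen Ω) (hΩb : Bornology.IsBounded Ω) {p q : ℝ}
    (hpq : p.HolderConjugate q) {u : Euc n → X} (hu : StronglyMeasurable u)
    (hE : ksEnergy Ω p u < ⊤) {ψ : Euc n → ℝ} (hψ : ψ ∈ testFunctions Ω) :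
    liminf (fun h => ∫⁻ v in ball (0 : Euc n) 1, quotEnergy 1 u (fun x => |ψ x|) h v) (𝓝[>] 0) ≤
      (((ksConst n p)⁻¹ * (ksEnergy Ω p u + 1)) ^ (1 / p) *
        volume (ball (0 : Euc n) 1) ^ (1 / q)) *
          eLpNorm ψ (ENNReal.ofReal q) (volume.restrict Ω) := by
  have hp0 := hpq.pos
  obtain ⟨η, hη, hη1⟩ := exists_cutoff hΩ hψ.2.1 hψ.2.2
  -- Adding 1 makes the inequality strict, so that it holds for all small h and not only for the
  -- limsup.
  have h1 : limsup (fun h : ℝ => ∫⁻ x in Ω, approxEnergy Ω p u h x * ENNReal.ofReal (η x))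
      (𝓝[>] 0) < ksEnergy Ω p u + 1 :=
    (le_iSup₂ (f := fun (f : Euc n → ℝ) (_ : IsNonnegCc Ω f ∧ ∀ x, f x ≤ 1) =>
      limsup (fun h : ℝ => ∫⁻ x in Ω, approxEnergy Ω p u h x * ENNReal.ofReal (f x)) (𝓝[>] 0))
      η hη).trans_lt (ENNReal.lt_add_right hE.ne one_ne_zero)
  have hK0 := ksConst_ne_zero hn hp0.le
  refine liminf_le_of_frequently_le' (Eventually.frequently ?_)
  filter_upwards [eventually_lt_of_limsup_lt h1,
    eventually_lintegral_approxEnergy_eq hn hΩ hΩb hp0.le hu hη.1] with h hlt heq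
  rw [heq] at hlt
  refine (lintegral_quotEnergy_one_le hpq hu hψ hη.1.continuous.measurable hη1 h).trans ?_
  rw [mul_assoc]
  refine mul_le_mul' (ENNReal.rpow_le_rpow ?_ (by positivity)) le_rfl
  rw [mul_comm, ← div_eq_mul_inv, ENNReal.le_div_iff_mul_le (Or.inl hK0)
    (Or.inl (ksConst_ne_top n p)), mul_comm]
  exact hlt.le

lemma exists_integrable_isWeakGradient {n : ℕ} (hn : 0 < n) {X : Type*} [MetricSpace X]
    {Ω : Set (Euc n)} (hΩ : IsOpen Ω) (hΩb : Bornology.IsBounded Ω) {p : ℝ} (hp : 1 ≤ p)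
    {u : Euc n → X} (hus : StronglyMeasurable u) (hu : MemKSSobolev Ω p u) (ξ : X) :
    ∃ g : Euc n → Euc n, IsWeakGradient Ω (fun x => dist (u x) ξ) g ∧ Integrable g := by
  have : IsFiniteMeasure (volume.restrict Ω) := ⟨by simpa using hΩb.measure_lt_top⟩
  have hfi : IntegrableOn (fun x => dist (u x) ξ) Ω :=
    (hu.memLp.memLp_dist hΩb ξ).integrable (by simpa using hp)
  rcases hp.eq_or_lt with rfl | hp1
  · obtain ⟨μ, hμ, hac⟩ := hu.absCont rfl
    have := hμ.finite
    exact exists_isWeakGradient_of_liminf_le hn hΩ hΩb hus ξ hfi μ hac le_rfl ENNReal.one_ne_top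
      (ENNReal.inv_ne_top.2 (ksConst_ne_zero hn zero_le_one))
      fun ψ hψ => liminf_quotEnergy_one_le_of_isEnergyMeasure hn hΩ hΩb hus hμ hψ
  · have hpq := Real.HolderConjugate.conjExponent hp1
    refine exists_isWeakGradient_of_liminf_le hn hΩ hΩb hus ξ hfi (volume.restrict Ω)
      Measure.absolutelyContinuous_restrict (q := ENNReal.ofReal p.conjExponent)
      (by simpa using hpq.symm.lt.le) ENNReal.ofReal_ne_top ?_
      fun ψ hψ => liminf_quotEnergy_one_le_of_ksEnergy_lt_top hn hΩ hΩb hpq hus hu.energy_lt_top hψ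
    have hp0 := hpq.pos
    have hq0 := hpq.symm.pos
    refine ENNReal.mul_ne_top (ENNReal.rpow_ne_top_of_nonneg (by positivity) (ENNReal.mul_ne_top
      (ENNReal.inv_ne_top.2 (ksConst_ne_zero hn hp0.le)) ?_))
      (ENNReal.rpow_ne_top_of_nonneg (by positivity) measure_ball_lt_top.ne)
    exact ENNReal.add_ne_top.2 ⟨hu.energy_lt_top.ne, ENNReal.one_ne_top⟩

/-! ### Integrability of the density and of the gradients -/

/-- The lower bound, taken over all cutoffs. The sequence ξ is arbitrary, so it serves both for the
density Γ and, with a constant sequence, for a single gradient. -/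
lemma lintegral_gradSup_le_ksEnergy {n : ℕ} (hn : 0 < n) {X : Type*} [MetricSpace X]
    {Ω : Set (Euc n)} (hΩ : IsOpen Ω) (hΩb : Bornology.IsBounded Ω) {p : ℝ} (hp : 0 ≤ p)
    {u : Euc n → X} (hu : StronglyMeasurable u) {ξ : ℕ → X} {G : ℕ → Euc n → Euc n}
    (hG : ∀ j, StronglyMeasurable (G j))
    (hw : ∀ j, IsWeakGradient Ω (fun x => dist (u x) (ξ j)) (G j)) :
    ∫⁻ x in Ω, ksConst n p * ∫⁻ v in ball (0 : Euc n) 1, gradSup G v x ^ p ≤ ksEnergy Ω p u := by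
  have hm : Measurable (fun x => ksConst n p * ∫⁻ v in ball (0 : Euc n) 1, gradSup G v x ^ p) :=
    (((measurable_gradSup hG).pow_const p).lintegral_prod_left').const_mul _
  refine (setLIntegral_le_iSup_cutoff hΩ volume hm.aemeasurable).trans
    (iSup₂_mono fun η hη => ?_)
  refine (lintegral_gradSup_le_liminf hΩ hp hu hG hw hη.1).trans ?_
  rw [limsup_congr (eventually_lintegral_approxEnergy_eq hn hΩ hΩb hp hu hη.1)]
  exact liminf_le_limsup

lemma mul_rpow_le_lintegral_inner {n : ℕ} {p : ℝ} (hp : 0 < p) (y : Euc n) :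
    volume (ball (0 : Euc n) (1 / 4)) * (‖y‖ₑ / 4) ^ p ≤
      ∫⁻ v in ball (0 : Euc n) 1, ‖(inner ℝ v y : ℝ)‖ₑ ^ p := by
  rcases eq_or_ne y 0 with rfl | hy
  · simp [hp]
  have hy0 : 0 < ‖y‖ := norm_pos_iff.2 hy
  -- On the ball of radius 1/4 about this vector, ⟨v, y⟩ is at least ‖y‖/2 - ‖y‖/4, and the ball
  -- lies in the unit ball.
  set e : Euc n := (2 * ‖y‖)⁻¹ • y with he
  have hen : ‖e‖ = 1 / 2 := by
    rw [he, norm_smul, norm_inv, norm_mul, norm_norm]; field_simp; norm_num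
  have hsub : ball e (1 / 4) ⊆ ball (0 : Euc n) 1 := ball_subset_ball' (by
    rw [dist_zero_right, hen]; norm_num)
  have hlow : ∀ v ∈ ball e (1 / 4), (‖y‖ₑ / 4) ^ p ≤ ‖(inner ℝ v y : ℝ)‖ₑ ^ p := by
    intro v hv
    refine ENNReal.rpow_le_rpow ?_ hp.le
    have h1 : (inner ℝ e y : ℝ) = ‖y‖ / 2 := by
      rw [he, inner_smul_left, real_inner_self_eq_norm_sq]; simp; field_simp
    have h2 : |(inner ℝ (v - e) y : ℝ)| ≤ 1 / 4 * ‖y‖ :=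
      (abs_real_inner_le_norm _ _).trans
        (mul_le_mul_of_nonneg_right (by rw [← dist_eq_norm]; exact hv.le) hy0.le)
    have h3 : ‖y‖ / 4 ≤ ‖(inner ℝ v y : ℝ)‖ := by
      have := neg_abs_le (inner ℝ (v - e) y : ℝ)
      rw [inner_sub_left] at this h2
      have := le_abs_self (inner ℝ v y : ℝ)
      rw [Real.norm_eq_abs]; linarith
    calc ‖y‖ₑ / 4 = ENNReal.ofReal (‖y‖ / 4) := by
          rw [ENNReal.ofReal_div_of_pos (by norm_num), ofReal_norm]; simp
      _ ≤ ENNReal.ofReal ‖(inner ℝ v y : ℝ)‖ := ENNReal.ofReal_le_ofReal h3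
      _ = _ := ofReal_norm _
  calc volume (ball (0 : Euc n) (1 / 4)) * (‖y‖ₑ / 4) ^ p
      = ∫⁻ _ in ball e (1 / 4), (‖y‖ₑ / 4) ^ p := by
        rw [setLIntegral_const, Measure.addHaar_ball_center _ e, mul_comm]
    _ ≤ ∫⁻ v in ball e (1 / 4), ‖(inner ℝ v y : ℝ)‖ₑ ^ p :=
        setLIntegral_mono' measurableSet_ball hlow
    _ ≤ _ := lintegral_mono_set hsub

/-- Distance functions of a Korevaar–Schoen Sobolev map are Sobolev functions. -/
lemma exists_memLp_isWeakGradient {n : ℕ} (hn : 0 < n) {X : Type*} [MetricSpace X]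
    {Ω : Set (Euc n)} (hΩ : IsOpen Ω) (hΩb : Bornology.IsBounded Ω) {p : ℝ} (hp : 1 ≤ p)
    {u : Euc n → X} (hus : StronglyMeasurable u) (hu : MemKSSobolev Ω p u) (ξ : X) :
    ∃ g : Euc n → Euc n, IsWeakGradient Ω (fun x => dist (u x) ξ) g ∧
      MemLp g (ENNReal.ofReal p) (volume.restrict Ω) := by
  have hp0 : 0 < p := by linarith
  obtain ⟨g₀, hw₀, hi₀⟩ := exists_integrable_isWeakGradient hn hΩ hΩb hp hus hu ξ
  obtain ⟨g, hg, hgg⟩ := hi₀.1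
  have hw : IsWeakGradient Ω (fun x => dist (u x) ξ) g := by
    refine ⟨hw₀.locInt, ((integrable_congr hgg).1 hi₀).integrableOn.locallyIntegrableOn,
      fun ψ h1 h2 h3 w => ?_⟩
    rw [hw₀.integral_eq ψ h1 h2 h3 w]
    refine congrArg _ (integral_congr_ae (ae_restrict_of_ae ?_))
    filter_upwards [hgg] with x hx using by rw [hx]
  refine ⟨g, hw, hg.aestronglyMeasurable, ?_⟩
  rw [eLpNorm_lt_top_iff_lintegral_rpow_enorm_lt_top (by simpa using hp0) ENNReal.ofReal_ne_top,
    ENNReal.toReal_ofReal hp0.le]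
  -- With a constant sequence the supremum is |v · g|, whose p-th power integrated over v is
  -- comparable to |g|^p from below.
  have h1 := (lintegral_gradSup_le_ksEnergy hn hΩ hΩb hp0.le hus (ξ := fun _ => ξ)
    (G := fun _ => g) (fun _ => hg) (fun _ => hw)).trans_lt hu.energy_lt_top
  simp only [gradSup, ciSup_const] at h1
  set c : ℝ≥0∞ := ksConst n p * (volume (ball (0 : Euc n) (1 / 4)) * (4⁻¹) ^ p) with hc
  have hc0 : c ≠ 0 := mul_ne_zero (ksConst_ne_zero hn hp0.le) (mul_ne_zero
    (measure_ball_pos _ _ (by norm_num)).ne' (by simp [ENNReal.rpow_eq_zero_iff, hp0.not_gt]))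
  have h2 : c * ∫⁻ x in Ω, ‖g x‖ₑ ^ p < ⊤ := by
    refine lt_of_le_of_lt ?_ h1
    rw [← lintegral_const_mul _ (hg.enorm.pow_const p)]
    refine lintegral_mono fun x => ?_
    have := mul_rpow_le_lintegral_inner hp0 (g x)
    rw [div_eq_mul_inv ‖g x‖ₑ, ENNReal.mul_rpow_of_nonneg _ _ hp0.le] at this
    calc c * ‖g x‖ₑ ^ p = ksConst n p * (volume (ball (0 : Euc n) (1 / 4)) *
          (‖g x‖ₑ ^ p * 4⁻¹ ^ p)) := by rw [hc]; ring
      _ ≤ _ := mul_le_mul' le_rfl this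
  exact ENNReal.lt_top_of_mul_ne_top_right h2.ne hc0

/-! ### Independence of representatives -/

/-- For fixed x, the v for which x + hv hits the exceptional null set form a null set. This permits
replacing u by a strongly measurable representative. -/
lemma approxEnergy_congr_ae {n : ℕ} {X : Type*} [MetricSpace X] {Ω : Set (Euc n)}
    (hΩ : IsOpen Ω) {p : ℝ} {u w : Euc n → X} (huw : u =ᵐ[volume.restrict Ω] w) {h : ℝ}
    (hh : 0 < h) : approxEnergy Ω p u h =ᵐ[volume.restrict Ω] approxEnergy Ω p w h := by
  have hN : volume {y | ¬ (y ∈ Ω → u y = w y)} = 0 :=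
    ae_iff.1 ((ae_restrict_iff' hΩ.measurableSet).1 huw)
  filter_upwards [huw] with x hx
  unfold approxEnergy
  split_ifs with hxi
  · congr 1
    refine setLIntegral_congr_fun_ae measurableSet_ball ?_
    have hnull : volume ((fun v : Euc n => h • v) ⁻¹'
        ((fun z => x + z) ⁻¹' {y | ¬ (y ∈ Ω → u y = w y)})) = 0 := by
      rw [Measure.addHaar_preimage_smul _ hh.ne', measure_preimage_add, hN, mul_zero]
    filter_upwards [show ∀ᵐ v : Euc n, (x + h • v ∈ Ω → u (x + h • v) = w (x + h • v)) from
      ae_iff.2 hnull] with v hv hvb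
    rw [hx, hv (add_mem_of_mem_innerSet hΩ hxi ?_)]
    rw [norm_smul, Real.norm_of_nonneg hh.le]
    exact mul_le_of_le_one_right hh.le (mem_ball_zero_iff.1 hvb).le
  · rfl

lemma eventually_lintegral_approxEnergy_congr_ae {n : ℕ} {X : Type*} [MetricSpace X]
    {Ω : Set (Euc n)} (hΩ : IsOpen Ω) {p : ℝ} {u w : Euc n → X}
    (huw : u =ᵐ[volume.restrict Ω] w) (η : Euc n → ℝ) :
    (fun h => ∫⁻ x in Ω, approxEnergy Ω p u h x * ENNReal.ofReal (η x)) =ᶠ[𝓝[>] 0]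
      fun h => ∫⁻ x in Ω, approxEnergy Ω p w h x * ENNReal.ofReal (η x) := by
  filter_upwards [self_mem_nhdsWithin] with h hh
  refine lintegral_congr_ae ?_
  filter_upwards [approxEnergy_congr_ae hΩ huw hh] with x hx using by rw [hx]

lemma ksEnergy_congr_ae {n : ℕ} {X : Type*} [MetricSpace X] {Ω : Set (Euc n)}
    (hΩ : IsOpen Ω) {p : ℝ} {u w : Euc n → X} (huw : u =ᵐ[volume.restrict Ω] w) :
    ksEnergy Ω p u = ksEnergy Ω p w :=
  iSup_congr fun η => iSup_congr fun _ =>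
    limsup_congr (eventually_lintegral_approxEnergy_congr_ae hΩ huw η)

lemma IsEnergyMeasure.congr_ae {n : ℕ} {X : Type*} [MetricSpace X] {Ω : Set (Euc n)}
    (hΩ : IsOpen Ω) {p : ℝ} {u w : Euc n → X} (huw : u =ᵐ[volume.restrict Ω] w)
    {μ : Measure (Euc n)} (h : IsEnergyMeasure Ω p u μ) : IsEnergyMeasure Ω p w μ :=
  ⟨h.finite, h.compl, fun f hf =>
    (h.tendsto f hf).congr' (eventually_lintegral_approxEnergy_congr_ae hΩ huw f)⟩

lemma dist_congr_ae {n : ℕ} {X : Type*} [MetricSpace X] {m : Measure (Euc n)}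
    {u w : Euc n → X} (huw : u =ᵐ[m] w) (ξ : X) :
    (fun x => dist (u x) ξ) =ᵐ[m] fun x => dist (w x) ξ := by
  filter_upwards [huw] with x hx using by rw [hx]

lemma MemKSSobolev.congr_ae {n : ℕ} {X : Type*} [MetricSpace X] {Ω : Set (Euc n)}
    (hΩ : IsOpen Ω) {p : ℝ} {u w : Euc n → X} (huw : u =ᵐ[volume.restrict Ω] w)
    (h : MemKSSobolev Ω p u) : MemKSSobolev Ω p w := by
  obtain ⟨⟨hm, ξ, hξ⟩, hE, hac⟩ := h
  refine ⟨⟨hm.congr huw, ξ, (memLp_congr_ae (dist_congr_ae huw ξ)).1 hξ⟩,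
    ksEnergy_congr_ae hΩ huw ▸ hE, fun hp => ?_⟩
  obtain ⟨μ, hμ, hμac⟩ := hac hp
  exact ⟨μ, hμ.congr_ae hΩ huw, hμac⟩

lemma locallyIntegrableOn_congr_ae {n : ℕ} {F : Type*} [NormedAddCommGroup F] {Ω : Set (Euc n)}
    {f g : Euc n → F} (hf : LocallyIntegrableOn f Ω)
    (hfg : f =ᵐ[volume.restrict Ω] g) : LocallyIntegrableOn g Ω := by
  intro x hx
  obtain ⟨t, ht, hft⟩ := hf x hx
  refine ⟨t ∩ Ω, inter_mem ht self_mem_nhdsWithin, ?_⟩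
  exact (hft.mono_set Set.inter_subset_left).congr_fun_ae
    (ae_restrict_of_ae_restrict_of_subset Set.inter_subset_right hfg)

lemma IsWeakGradient.congr_ae {n : ℕ} {Ω : Set (Euc n)} {f f' : Euc n → ℝ}
    {G G' : Euc n → Euc n} (h : IsWeakGradient Ω f G) (hf : f =ᵐ[volume.restrict Ω] f')
    (hG : G =ᵐ[volume.restrict Ω] G') : IsWeakGradient Ω f' G' := by
  refine ⟨locallyIntegrableOn_congr_ae h.locInt hf,
    locallyIntegrableOn_congr_ae h.locInt_grad hG, fun ψ h1 h2 h3 w => ?_⟩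
  have e1 : ∫ x in Ω, f' x * fderiv ℝ ψ x w = ∫ x in Ω, f x * fderiv ℝ ψ x w :=
    integral_congr_ae (by filter_upwards [hf] with x hx using by rw [hx])
  have e2 : ∫ x in Ω, inner ℝ w (G' x) * ψ x = ∫ x in Ω, inner ℝ w (G x) * ψ x :=
    integral_congr_ae (by filter_upwards [hG] with x hx using by rw [hx])
  rw [e1, e2, h.integral_eq ψ h1 h2 h3 w]

/-! ### Cutoffs, energy measures and the conclusion -/

lemma lintegral_mul_le_setLIntegral {n : ℕ} {Ω : Set (Euc n)} (hΩ : IsOpen Ω)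
    (m : Measure (Euc n)) (Γ : Euc n → ℝ≥0∞) {η : Euc n → ℝ} (hη : IsNonnegCc Ω η)
    (hη1 : ∀ x, η x ≤ 1) : ∫⁻ x, ENNReal.ofReal (η x) * Γ x ∂m ≤ ∫⁻ x in Ω, Γ x ∂m := by
  rw [← lintegral_indicator hΩ.measurableSet]
  refine lintegral_mono fun x => ?_
  by_cases hx : x ∈ Ω
  · rw [Set.indicator_of_mem hx]
    exact mul_le_of_le_one_left' (ENNReal.ofReal_le_one.2 (hη1 x))
  · rw [image_eq_zero_of_notMem_tsupport fun h => hx (hη.support h)]; simp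

lemma iSup_cutoff_lintegral_eq {n : ℕ} {Ω : Set (Euc n)} (hΩ : IsOpen Ω)
    (m : Measure (Euc n)) {Γ : Euc n → ℝ≥0∞} (hΓ : AEMeasurable Γ m) :
    ⨆ (η : Euc n → ℝ) (_ : IsNonnegCc Ω η ∧ ∀ x, η x ≤ 1),
      ∫⁻ x, ENNReal.ofReal (η x) * Γ x ∂m = ∫⁻ x in Ω, Γ x ∂m :=
  le_antisymm (iSup₂_le fun _ hη => lintegral_mul_le_setLIntegral hΩ m Γ hη.1 hη.2)
    (setLIntegral_le_iSup_cutoff hΩ m hΓ)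

lemma IsNonnegCc.mono {n : ℕ} {Ω Ω' : Set (Euc n)} (h : Ω' ⊆ Ω) {η : Euc n → ℝ}
    (hη : IsNonnegCc Ω' η) : IsNonnegCc Ω η :=
  ⟨hη.continuous, hη.compact, hη.support.trans h, hη.nonneg⟩

/-- Suprema over cutoffs recover the mass of every open set, and open sets form a generating
π-system. -/
lemma measure_ext_of_forall_isNonnegCc {n : ℕ} {Ω : Set (Euc n)} (hΩ : IsOpen Ω)
    {μ ν : Measure (Euc n)} [IsFiniteMeasure μ] (hμ : μ Ωᶜ = 0) (hν : ν Ωᶜ = 0)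
    (h : ∀ η : Euc n → ℝ, IsNonnegCc Ω η →
      ∫⁻ x, ENNReal.ofReal (η x) ∂μ = ∫⁻ x, ENNReal.ofReal (η x) ∂ν) : μ = ν := by
  have hopen : ∀ U : Set (Euc n), IsOpen U → μ U = ν U := by
    intro U hU
    rw [← measure_inter_conull hμ, ← measure_inter_conull hν]
    have hV := hU.inter hΩ
    have e := fun m : Measure (Euc n) =>
      iSup_cutoff_lintegral_eq hV m (Γ := fun _ => 1) aemeasurable_const
    simp only [mul_one, setLIntegral_one] at e
    rw [← e μ, ← e ν]
    exact iSup_congr fun η => iSup_congr fun hη => h η (hη.1.mono Set.inter_subset_right)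
  exact ext_of_generate_finite _ (BorelSpace.measurable_eq (α := Euc n)) isPiSystem_isOpen
    (fun U hU => hopen U hU) (hopen _ isOpen_univ)

/-- The two bounds meet. `quotEnergy` does not see the domain once η is compactly supported in Ω',
so the gradients on Ω serve every open subset and localization comes for free. -/
lemma tendsto_lintegral_approxEnergy {n : ℕ} (hn : 0 < n) {X : Type*} [MetricSpace X]
    {Ω : Set (Euc n)} (hΩ : IsOpen Ω) (hΩb : Bornology.IsBounded Ω) {p : ℝ} (hp : 1 ≤ p)
    {u : Euc n → X} (hu : StronglyMeasurable u) (hE : ksEnergy Ω p u < ⊤)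
    {ξ : ℕ → X} (hξ : DenseRange ξ) {G : ℕ → Euc n → Euc n} (hG : ∀ j, StronglyMeasurable (G j))
    (hw : ∀ j, IsWeakGradient Ω (fun x => dist (u x) (ξ j)) (G j))
    {Ω' : Set (Euc n)} (hΩ' : IsOpen Ω') (hsub : Ω' ⊆ Ω) {η : Euc n → ℝ} (hη : IsNonnegCc Ω' η) :
    Tendsto (fun h : ℝ => ∫⁻ x in Ω', approxEnergy Ω' p u h x * ENNReal.ofReal (η x)) (𝓝[>] 0)
      (𝓝 (∫⁻ x, ENNReal.ofReal (η x) *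
        (ksConst n p * ∫⁻ v in ball (0 : Euc n) 1, gradSup G v x ^ p))) := by
  have hp0 : 0 ≤ p := by linarith
  refine Tendsto.congr' (eventually_lintegral_approxEnergy_eq hn hΩ' (hΩb.subset hsub) hp0 hu
    hη).symm (tendsto_of_le_liminf_of_limsup_le
    (lintegral_gradSup_le_liminf hΩ hp0 hu hG hw (hη.mono hsub)) ?_)
  exact limsup_quotEnergy_le hΩ hp hu hξ hG hw
    ((lintegral_gradSup_le_ksEnergy hn hΩ hΩb hp0 hu hG hw).trans_lt hE).ne (hη.mono hsub)

lemma sphereDensity_ae_eq {n : ℕ} (hn : 0 < n) {X : Type*} {Ω : Set (Euc n)} {p : ℝ}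
    [MetricSpace X] (hp : 0 ≤ p) {ξ : ℕ → X} {G : X → Euc n → Euc n} {g : ℕ → Euc n → Euc n}
    (hGg : ∀ j, G (ξ j) =ᵐ[volume.restrict Ω] g j) :
    sphereDensity p (Set.range ξ) G =ᵐ[volume.restrict Ω]
      fun x => ksConst n p * ∫⁻ v in ball (0 : Euc n) 1, gradSup g v x ^ p := by
  filter_upwards [ae_all_iff.2 hGg] with x hx
  have e : ∀ ν, absPartial (Set.range ξ) G ν x = gradSup g ν x := fun ν => by
    simp only [absPartial, gradSup, iSup_range, hx]
  rw [ksConst_mul_lintegral_ball hn hp ((measurable_gradSup_left g x).pow_const p)]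
  · simp only [sphereDensity, e]
  · intro r hr v
    rw [← ENNReal.mul_rpow_of_nonneg _ _ hp, gradSup, gradSup, ENNReal.mul_iSup]
    simp only [inner_smul_left, enorm_mul]
    simp [Real.enorm_of_nonneg hr.le]

theorem theorem1 {X : Type*} [MetricSpace X] [CompleteSpace X] [TopologicalSpace.SeparableSpace X]
    {n : ℕ} (hn : 0 < n) {p : ℝ} (hp : 1 ≤ p) {Ω : Set (Euc n)} (hΩ : IsOpen Ω)
    (hΩb : Bornology.IsBounded Ω) {u : Euc n → X} (hu : MemKSSobolev Ω p u) :
    -- each `d(u, ξ)` belongs to `W^{1,p}(Ω)`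
    (∀ ξ : X, MemLp (fun x => dist (u x) ξ) (ENNReal.ofReal p) (volume.restrict Ω) ∧
      ∃ g : Euc n → Euc n, IsWeakGradient Ω (fun x => dist (u x) ξ) g ∧
        MemLp g (ENNReal.ofReal p) (volume.restrict Ω)) ∧
    -- for every countable dense `D` and every choice of the weak gradients `∇ d(u, ξ)`
    ∀ D : Set X, D.Countable → Dense D → ∀ G : X → Euc n → Euc n,
      (∀ ξ ∈ D, IsWeakGradient Ω (fun x => dist (u x) ξ) (G ξ)) →
      -- the representation formula
      AEMeasurable (sphereDensity p D G) (volume.restrict Ω) ∧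
      ksEnergy Ω p u = ∫⁻ x in Ω, sphereDensity p D G x ∧
      -- its localization to open subsets
      (∀ Ω' : Set (Euc n), IsOpen Ω' → Ω' ⊆ Ω →
        ksEnergy Ω' p u = ∫⁻ x in Ω', sphereDensity p D G x) ∧
      -- the energy measure has exactly this density
      IsEnergyMeasure Ω p u ((volume.restrict Ω).withDensity (sphereDensity p D G)) ∧
      ∀ h : Euc n → ℝ≥0∞, AEMeasurable h (volume.restrict Ω) →
        IsEnergyMeasure Ω p u ((volume.restrict Ω).withDensity h) →
        h =ᵐ[volume.restrict Ω] sphereDensity p D G := by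
  have hp0 : 0 ≤ p := by linarith
  obtain ⟨w, hws, huw⟩ := hu.memLp.1
  have hw := hu.congr_ae hΩ huw
  refine ⟨fun ξ => ⟨hu.memLp.memLp_dist hΩb ξ, ?_⟩, fun D hDc hDd G hG => ?_⟩
  · obtain ⟨g, hg, hgp⟩ := exists_memLp_isWeakGradient hn hΩ hΩb hp hws hw ξ
    exact ⟨g, hg.congr_ae (dist_congr_ae huw.symm ξ) .rfl, hgp⟩
  obtain ⟨ξ₀, -⟩ := hu.memLp.2
  have : Nonempty X := ⟨ξ₀⟩
  obtain ⟨ξ, rfl⟩ := hDc.exists_eq_range hDd.nonempty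
  have hξ : DenseRange ξ := hDd
  -- The given gradients are only almost everywhere measurable on Ω; countability lets them be
  -- replaced by strongly measurable ones off a single null set.
  choose g hgs hGg using fun j => (hG (ξ j) ⟨j, rfl⟩).locInt_grad.aestronglyMeasurable
  have hgw : ∀ j, IsWeakGradient Ω (fun x => dist (w x) (ξ j)) (g j) := fun j =>
    (hG (ξ j) ⟨j, rfl⟩).congr_ae (dist_congr_ae huw _) (hGg j)
  have hρ := sphereDensity_ae_eq hn hp0 hGg
  set Γ : Euc n → ℝ≥0∞ := fun x =>
    ksConst n p * ∫⁻ v in ball (0 : Euc n) 1, gradSup g v x ^ p with hΓ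
  have hΓm : Measurable Γ :=
    (((measurable_gradSup hgs).pow_const p).lintegral_prod_left').const_mul _
  have htend := fun (Ω' : Set (Euc n)) (hΩ' : IsOpen Ω') (hsub : Ω' ⊆ Ω) (η : Euc n → ℝ)
    (hη : IsNonnegCc Ω' η) => (tendsto_lintegral_approxEnergy hn hΩ hΩb hp hws hw.energy_lt_top hξ
      hgs hgw hΩ' hsub hη).congr' (eventually_lintegral_approxEnergy_congr_ae hΩ'
        (ae_restrict_of_ae_restrict_of_subset hsub huw) η).symm
  have hloc : ∀ Ω' : Set (Euc n), IsOpen Ω' → Ω' ⊆ Ω →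
      ksEnergy Ω' p u = ∫⁻ x in Ω', sphereDensity p (Set.range ξ) G x := by
    intro Ω' hΩ' hsub
    rw [lintegral_congr_ae (ae_restrict_of_ae_restrict_of_subset hsub hρ),
      ← iSup_cutoff_lintegral_eq hΩ' volume hΓm.aemeasurable]
    -- Each limsup is a genuine limit, so the energy is a supremum of ∫ η Γ over cutoffs.
    exact iSup_congr fun η => iSup_congr fun hη => (htend Ω' hΩ' hsub η hη.1).limsup_eq
  have hfin : ∫⁻ x in Ω, sphereDensity p (Set.range ξ) G x ≠ ⊤ :=
    hloc Ω hΩ subset_rfl ▸ hu.energy_lt_top.ne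
  have hρm : AEMeasurable (sphereDensity p (Set.range ξ) G) (volume.restrict Ω) :=
    ⟨Γ, hΓm, hρ⟩
  have hmeas : IsEnergyMeasure Ω p u
      ((volume.restrict Ω).withDensity (sphereDensity p (Set.range ξ) G)) := by
    refine ⟨isFiniteMeasure_withDensity hfin, withDensity_absolutelyContinuous _ _
      (by simp [Measure.restrict_apply hΩ.measurableSet.compl]), fun η hη => ?_⟩
    convert htend Ω hΩ subset_rfl η hη using 2
    rw [withDensity_congr_ae hρ, lintegral_withDensity_eq_lintegral_mul _ hΓm
      hη.continuous.measurable.ennreal_ofReal, ← lintegral_indicator hΩ.measurableSet]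
    refine lintegral_congr fun x => ?_
    by_cases hx : x ∈ Ω
    · simp [hx, mul_comm, hΓ]
    · simp [hx, image_eq_zero_of_notMem_tsupport fun h => hx (hη.support h)]
  refine ⟨hρm, hloc Ω hΩ subset_rfl, hloc, hmeas, fun h hh hhm => ?_⟩
  have := hmeas.finite
  refine ((withDensity_eq_iff hρm hh hfin).1 (measure_ext_of_forall_isNonnegCc hΩ hmeas.compl
    hhm.compl fun η hη => ?_)).symm
  exact tendsto_nhds_unique (hmeas.tendsto η hη) (hhm.tendsto η hη)
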